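/- Let $V$ be a valuation domain of rank one (Krull dimension one) with quotient field $K$, let $v : K \to \mathbb R\cup\{\infty\}$ be the associated valuation, whose value group $\Gamma_v$ is regarded as a subgroup of $\mathbb R$, and let $\widehat K$ be the completion of $K$ with respect to the topology induced by $v$. Let $E=\{s_n\}_{n\in\mathbb N}\subset K$ be a pseudo-convergent sequence, i.e. $v(s_{n+1}-s_n)<v(s_{n+2}-s_{n+1})$ for all $n$. Its breadth is $\lim_{n\to\infty} v(s_{n+1}-s_n)\in\mathbb R\cup\{\infty\}$. The sequence $E$ is of transcendental type if for every $f\in K[X]$ the sequence $v(f(s_n))$ is eventually constant, and of algebraic type if for some $f\in K[X]$ the sequence $v(f(s_n))$ is eventually strictly increasing. Put $$V_E=\{\phi\in K(X) : \phi(s_n)\in V \text{ for all but finitely many } n\},\qquad w_E(\phi)=\lim_{n\to\infty} v(\phi(s_n))\quad(\phi\in K(X)),$$ and, when $w_E$ is a valuation $K(X)\to\mathbb R\cup\{\infty\}$, $W_E=\{\phi\in K(X): w_E(\phi)\ge 0\}$. A pseudo-limit of $E$ in $\widehat K$ is an element $\alpha\in\widehat K$ with $v(\alpha-s_n)<v(\alpha-s_{n+1})$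 for all $n$ (with $v$ extended to $\widehat K$). Then $V_E$ is a valuation domain of $K(X)$ (that is, for every $\phi\in K(X)$, $\phi\in V_E$ or $\phi^{-1}\in V_E$), and the following hold, where the rank of $V_E$ is its Krull dimension. (a) If $E$ is of transcendental type, then $w_E$ is a valuation on $K(X)$, and $V_E=W_E$ has rank $1$. (b) If $E$ is of algebraic type and its breadth is infinite, then $V_E$ has rank $2$. Furthermore, $E$ has exactly one pseudo-limit $\alpha$ in $\widehat K$, it is algebraic over $K$, and if $q\in K[X]$ is its minimal polynomial over $K$, then the localization $K[X]_{(q)}$ contains $V_E$ and is the unique one-dimensional ring between $V_E$ and $K(X)$. (c) If $E$ is of algebraic type with breadth $\delta\in\mathbb R$, then $w_E$ is a valuation on $K(X)$, $W_E$ lies over $V$ (i.e. $W_E\cap K=V$), and the following conditions are equivalent: (i) $\delta$ is not torsion over $\Gamma_v$, i.e. $k\delta\notin\Gamma_v$ for every integer $k\ge 1$; (ii) $W_E$ is not residually transcendental over $V$, i.e. the residue field of $W_E$ is an algebraic extension of the residue field of $V$; (iii) $V_E$ has rank one; (iv) $V_E=W_E$; (v) $V_E\cap K[X]=W_E\cap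 K[X]$. -/

import Mathlib

open Filter Topology Polynomial

/-- The evaluation `φ(a) ∈ K` of a rational function `φ ∈ K(X)`; it is only meaningful when `a` is
not a pole of `φ`, i.e. when the (reduced) denominator does not vanish at `a`. -/
noncomputable def ratEval {K : Type*} [Field K] (φ : RatFunc K) (a : K) : K :=
  φ.eval (RingHom.id K) a

/-- `s` is a pseudo-convergent sequence with respect to `v`. -/
def IsPseudoConvergent {K : Type*} [Field K] (v : AddValuation K (WithTop ℝ)) (s : ℕ → K) : Prop :=
  ∀ n, v (s (n + 1) - s n) < v (s (n + 2) - s (n + 1))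

/-- `δ ∈ ℝ ∪ {∞}` is the breadth of `s`: the limit of the gauge `v (s (n + 1) - s n)`. -/
def HasBreadth {K : Type*} [Field K] (v : AddValuation K (WithTop ℝ)) (s : ℕ → K)
    (δ : WithTop ℝ) : Prop :=
  Tendsto (fun n => v (s (n + 1) - s n)) atTop (𝓝 δ)

/-- Transcendental type: `v (f (s n))` eventually stabilizes, for every polynomial `f`. -/
def IsTranscendentalType {K : Type*} [Field K] (v : AddValuation K (WithTop ℝ)) (s : ℕ → K) :
    Prop :=
  ∀ f : K[X], ∃ c : WithTop ℝ, ∀ᶠ n in atTop, v (f.eval (s n)) = c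

/-- Algebraic type: `v (f (s n))` is eventually (strictly) increasing, for some polynomial `f`. -/
def IsAlgebraicType {K : Type*} [Field K] (v : AddValuation K (WithTop ℝ)) (s : ℕ → K) : Prop :=
  ∃ f : K[X], ∀ᶠ n in atTop, v (f.eval (s n)) < v (f.eval (s (n + 1)))

/-- `δ` is torsion over the value group of `v`: some positive multiple of `δ` lies in it. -/
def IsTorsionOver {K : Type*} [Field K] (v : AddValuation K (WithTop ℝ)) (δ : ℝ) : Prop :=
  ∃ k : ℕ, 0 < k ∧ ∃ c : K, v c = (((k : ℝ) * δ : ℝ) : WithTop ℝ)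

/-- `α` is a pseudo-limit of `s` with respect to a valuation `w`. The valuation is written
multiplicatively, so that strictly increasing additive values read as strictly decreasing ones. -/
def IsPseudoLimit {L Γ : Type*} [Field L] [LinearOrderedCommGroupWithZero Γ] (w : Valuation L Γ)
    (s : ℕ → L) (α : L) : Prop :=
  ∀ n, w (α - s (n + 1)) < w (α - s n)

/-- This makes the completion of `K` with respect to `v` a `K`-algebra (through the instance that
Mathlib provides for completions). -/
instance uniformContinuousConstSMul_withVal {K Γ : Type*} [Field K]
    [LinearOrderedCommGroupWithZero Γ] (v : Valuation K Γ) :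
    UniformContinuousConstSMul K (WithVal v) :=
  ⟨fun c => uniformContinuous_const_smul (WithVal.toVal v c)⟩

/-- The ring `V_E` of the rational functions `φ` such that, for all but finitely many `n`, `φ` is
defined at `s n` and `φ (s n) ∈ V`. -/
noncomputable def ringVE {K : Type*} [Field K] (V : ValuationSubring K) (s : ℕ → K) :
    Subring (RatFunc K) where
  carrier := {φ | ∀ᶠ n in atTop, φ.denom.eval (s n) ≠ 0 ∧ ratEval φ (s n) ∈ V}
  zero_mem' := by simp [ratEval]
  one_mem' := by simp [ratEval]
  add_mem' := by
    intro a b ha hb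
    filter_upwards [ha, hb] with n h1 h2
    refine ⟨fun h0 => ?_, ?_⟩
    · obtain ⟨c, hc⟩ := RatFunc.denom_add_dvd a b
      have := congrArg (Polynomial.eval (s n)) hc
      simp only [Polynomial.eval_mul, h0, zero_mul] at this
      exact (mul_ne_zero h1.1 h2.1) this
    · have : ratEval (a + b) (s n) = ratEval a (s n) + ratEval b (s n) :=
        RatFunc.eval_add (RingHom.id K) (s n) h1.1 h2.1
      rw [this]
      exact V.add_mem _ _ h1.2 h2.2
  mul_mem' := by
    intro a b ha hb
    filter_upwards [ha, hb] with n h1 h2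
    refine ⟨fun h0 => ?_, ?_⟩
    · obtain ⟨c, hc⟩ := RatFunc.denom_mul_dvd a b
      have := congrArg (Polynomial.eval (s n)) hc
      simp only [Polynomial.eval_mul, h0, zero_mul] at this
      exact (mul_ne_zero h1.1 h2.1) this
    · have : ratEval (a * b) (s n) = ratEval a (s n) * ratEval b (s n) :=
        RatFunc.eval_mul (RingHom.id K) (s n) h1.1 h2.1
      rw [this]
      exact V.mul_mem _ _ h1.2 h2.2
  neg_mem' := by
    intro a ha
    have key : -a = RatFunc.C (-1 : K) * a := by simp
    have hC : (RatFunc.C (-1 : K)).denom = 1 := RatFunc.denom_C _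
    filter_upwards [ha] with n h1
    have hC' : Polynomial.eval₂ (RingHom.id K) (s n) (RatFunc.C (-1 : K)).denom ≠ 0 := by
      rw [hC]; simp
    rw [key]
    refine ⟨fun h0 => ?_, ?_⟩
    · obtain ⟨c, hc⟩ := RatFunc.denom_mul_dvd (RatFunc.C (-1 : K)) a
      have := congrArg (Polynomial.eval (s n)) hc
      rw [Polynomial.eval_mul, Polynomial.eval_mul, h0, zero_mul] at this
      exact (mul_ne_zero hC' h1.1) this
    · have : ratEval (RatFunc.C (-1 : K) * a) (s n)
          = ratEval (RatFunc.C (-1 : K)) (s n) * ratEval a (s n) :=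
        RatFunc.eval_mul (RingHom.id K) (s n) hC' h1.1
      rw [this]
      have h2 : ratEval (RatFunc.C (-1 : K)) (s n) = -1 := by
        simp only [ratEval, RatFunc.eval_C]; rfl
      rw [h2, neg_one_mul]
      exact V.neg_mem _ h1.2

/-- `w` is the map `w_E : φ ↦ lim v (φ (s n))`, and this map is a valuation on `K(X)` (that `w`
satisfies the axioms of a valuation is part of its type). At most one `w` has this property. -/
def IsOstrowskiValuation {K : Type*} [Field K] (v : AddValuation K (WithTop ℝ)) (s : ℕ → K)
    (w : AddValuation (RatFunc K) (WithTop ℝ)) : Prop :=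
  ∀ φ : RatFunc K, Tendsto (fun n => v (ratEval φ (s n))) atTop (𝓝 (w φ))

/-- The valuation ring `{x | 0 ≤ w x}` of an additively written valuation `w` on a field. -/
def addValuationRing {L : Type*} [Field L] (w : AddValuation L (WithTop ℝ)) :
    ValuationSubring L where
  carrier := {x | 0 ≤ w x}
  zero_mem' := by simp
  one_mem' := by simp
  add_mem' := fun {a b} ha hb => (le_min ha hb).trans (w.map_add a b)
  mul_mem' := by
    intro a b ha hb
    simp only [Set.mem_ofPred_eq, w.map_mul] at *
    exact add_nonneg ha hb
  neg_mem' := by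
    intro a ha
    simpa only [Set.mem_ofPred_eq, w.map_neg] using ha
  mem_or_inv_mem' := by
    intro x
    by_cases hx : x = 0
    · left; simp [hx]
    · by_contra! h
      simp only [Set.mem_ofPred_eq, not_le] at h
      have h1 : w x + w x⁻¹ = 0 := by rw [← w.map_mul, mul_inv_cancel₀ hx, w.map_one]
      have h2 : w x + w x⁻¹ < 0 :=
        lt_of_le_of_lt (by simpa using add_le_add_right h.2.le (w x)) h.1
      exact absurd h1 h2.ne

/-- A valuation ring `W` of `L ⊇ K` lies over the valuation ring `V` of `K`: `W ∩ K = V`. -/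
def LiesOverValuationRing {K L : Type*} [Field K] [Field L] [Algebra K L] (V : ValuationSubring K)
    (W : ValuationSubring L) : Prop :=
  ∀ x : K, algebraMap K L x ∈ W ↔ x ∈ V

/-- The inclusion `V → W` when `W` lies over `V`. -/
def inclusionOfLiesOver {K L : Type*} [Field K] [Field L] [Algebra K L] {V : ValuationSubring K}
    {W : ValuationSubring L} (h : LiesOverValuationRing V W) : V →+* W :=
  ((algebraMap K L).comp V.subtype).codRestrict W fun x => (h x).2 x.2

theorem isLocalHom_inclusionOfLiesOver {K L : Type*} [Field K] [Field L] [Algebra K L]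
    {V : ValuationSubring K} {W : ValuationSubring L} (h : LiesOverValuationRing V W) :
    IsLocalHom (inclusionOfLiesOver h) := by
  constructor
  intro a ha
  obtain ⟨b, hb⟩ := ha.exists_right_inv
  have hb' : algebraMap K L a * (b : L) = 1 := congrArg (Subtype.val) hb
  have ha0 : (a : K) ≠ 0 := by
    intro h0
    simp [h0] at hb'
  have hbi : (b : L) = algebraMap K L (a : K)⁻¹ := by
    rw [map_inv₀]
    exact eq_inv_of_mul_eq_one_right hb'
  have hmem : (a : K)⁻¹ ∈ V := (h _).1 (hbi ▸ b.2)
  exact IsUnit.of_mul_eq_one ⟨(a : K)⁻¹, hmem⟩ (Subtype.ext (mul_inv_cancel₀ ha0))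

/-- `W`, lying over `V`, is residually transcendental over `V`: the residue field of `W` is a
transcendental extension of the residue field of `V`. -/
def IsResiduallyTranscendental {K L : Type*} [Field K] [Field L] [Algebra K L]
    {V : ValuationSubring K} {W : ValuationSubring L} (h : LiesOverValuationRing V W) : Prop :=
  letI := isLocalHom_inclusionOfLiesOver h
  letI := (IsLocalRing.ResidueField.map (inclusionOfLiesOver h)).toAlgebra
  Algebra.Transcendental (IsLocalRing.ResidueField V) (IsLocalRing.ResidueField W)

/-- `K[X]` as a subring of `K(X)`. -/
noncomputable def polynomialSubring (K : Type*) [Field K] : Subring (RatFunc K) :=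
  (algebraMap K[X] (RatFunc K)).range

/-- The localization `K[X]_(q)` of `K[X]` at the prime ideal generated by a prime polynomial `q`,
as a subring of `K(X)`. -/
noncomputable def localizationAt {K : Type*} [Field K] (q : K[X]) (hq : Prime q) :
    Subring (RatFunc K) where
  carrier := {φ | ∃ f g : K[X], ¬ q ∣ g ∧
    φ = algebraMap K[X] (RatFunc K) f / algebraMap K[X] (RatFunc K) g}
  zero_mem' := ⟨0, 1, fun h => hq.not_isUnit (isUnit_of_dvd_one h), by simp⟩
  one_mem' := ⟨1, 1, fun h => hq.not_isUnit (isUnit_of_dvd_one h), by simp⟩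
  add_mem' := by
    rintro _ _ ⟨f, g, hg, rfl⟩ ⟨f', g', hg', rfl⟩
    have h0 : algebraMap K[X] (RatFunc K) g ≠ 0 :=
      RatFunc.algebraMap_ne_zero (fun h => hg (h ▸ dvd_zero q))
    have h0' : algebraMap K[X] (RatFunc K) g' ≠ 0 :=
      RatFunc.algebraMap_ne_zero (fun h => hg' (h ▸ dvd_zero q))
    refine ⟨f * g' + g * f', g * g', fun h => (hq.dvd_or_dvd h).elim hg hg', ?_⟩
    rw [div_add_div _ _ h0 h0']
    simp
  mul_mem' := by
    rintro _ _ ⟨f, g, hg, rfl⟩ ⟨f', g', hg', rfl⟩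
    exact ⟨f * f', g * g', fun h => (hq.dvd_or_dvd h).elim hg hg', by
      rw [div_mul_div_comm, map_mul, map_mul]⟩
  neg_mem' := by
    rintro _ ⟨f, g, hg, rfl⟩
    exact ⟨-f, g, hg, by rw [map_neg, neg_div]⟩

/-!
The values of a rational function along a pseudo-convergent sequence `s` with gauge
`γ n = v (s (n + 1) - s n)` are eventually of the form `c + k γ n`, with `k` an integer and `c` a
real that is torsion over the value group. To see this, extend `v` to a real valuation `u` of an
algebraic closure (`exists_addValuation_extension`) and split the rational function into linear
factors: for each `β`, either `β` is a pseudo-limit and `u (s n - β) = γ n` for all `n`, or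
`u (s n - β)` is eventually constant (`IsPseudoConvergent.map_sub_or`). Since `γ` is increasing,
`c + k γ n` is eventually nonnegative or eventually negative, which makes `V_E` a valuation ring,
and its limit is `c + k δ` when the breadth `δ` is finite, which gives the valuation `w_E`. Ranks
are computed by listing overrings, the overrings of a valuation ring being in bijection with its
primes; the ring of a nontrivial real valuation has rank one.

For finite breadth, `V_E` is always contained in `W_E`. If `δ` is not torsion, then `c + k δ = 0`
forces `k = 0`, and the two rings agree; moreover a rational function is along `s` asymptotic to a
monomial `b (X - α) ^ k` around a pseudo-limit `α` (`exists_isAsympPrincipalUnit`), so that one of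
value `0` is asymptotic to a constant, and `W_E` has the same residue field as `V`. If `δ` is
torsion, a normalized power of a polynomial with increasing values has values increasing to `0`
(`exists_polynomial_map_neg`). This polynomial lies in `W_E` but not in `V_E`, and its residue is
transcendental, because a monic integral polynomial takes negative values at points of negative
value.

For infinite breadth, `s` converges in the completion to some `α`, which is a root of every
polynomial with increasing values. A polynomial `f` with `f(α) ≠ 0` has eventually constant values
along `s`, and one with `f(α) = 0` has values tending to infinity. This property of the minimal
polynomial `q` of `α` (`GovernsValues`) determines all the overrings of `V_E`: they are `V_E`,
`K[X]_(q)` and `K(X)`.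
-/

/-! ### Real values of nonzero elements -/

/-- The value of `x` as a real number; the junk value `0` is taken at `x = 0`. -/
noncomputable def realVal {K : Type*} [Field K] (v : AddValuation K (WithTop ℝ)) (x : K) : ℝ :=
  (v x).untopD 0

section realVal

variable {K : Type*} [Field K] (v : AddValuation K (WithTop ℝ))

theorem coe_realVal {x : K} (hx : x ≠ 0) : ((realVal v x : ℝ) : WithTop ℝ) = v x := by
  obtain ⟨r, hr⟩ := WithTop.ne_top_iff_exists.1 ((v.ne_top_iff).2 hx)
  rw [realVal, ← hr, WithTop.untopD_coe]

theorem realVal_eq {x : K} {r : ℝ} (h : v x = (r : WithTop ℝ)) : realVal v x = r := by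
  simp [realVal, h]

theorem ne_zero_of_map_eq_coe {x : K} {r : ℝ} (h : v x = (r : WithTop ℝ)) : x ≠ 0 := by
  rw [← v.ne_top_iff, h]; exact WithTop.coe_ne_top

theorem realVal_one : realVal v 1 = 0 := realVal_eq v (by simp)

theorem realVal_mul {x y : K} (hx : x ≠ 0) (hy : y ≠ 0) :
    realVal v (x * y) = realVal v x + realVal v y :=
  realVal_eq v (by rw [v.map_mul, WithTop.coe_add, coe_realVal v hx, coe_realVal v hy])

theorem realVal_inv {x : K} (hx : x ≠ 0) : realVal v x⁻¹ = - realVal v x := by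
  have := realVal_mul v hx (inv_ne_zero hx)
  rw [mul_inv_cancel₀ hx, realVal_one] at this
  linarith

theorem realVal_div {x y : K} (hx : x ≠ 0) (hy : y ≠ 0) :
    realVal v (x / y) = realVal v x - realVal v y := by
  rw [div_eq_mul_inv, realVal_mul v hx (inv_ne_zero hy), realVal_inv v hy, sub_eq_add_neg]

theorem realVal_pow {x : K} (hx : x ≠ 0) (n : ℕ) : realVal v (x ^ n) = n * realVal v x := by
  induction n with
  | zero => simp [realVal_one]
  | succ n ih => rw [pow_succ, realVal_mul v (pow_ne_zero n hx) hx, ih]; push_cast; ring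

theorem realVal_zpow {x : K} (hx : x ≠ 0) (k : ℤ) : realVal v (x ^ k) = k * realVal v x := by
  cases k with
  | ofNat n => simpa using realVal_pow v hx n
  | negSucc n =>
    rw [zpow_negSucc, realVal_inv v (pow_ne_zero _ hx), realVal_pow v hx]
    push_cast; ring

theorem zero_le_map_iff {x : K} (hx : x ≠ 0) : 0 ≤ v x ↔ 0 ≤ realVal v x := by
  rw [← coe_realVal v hx, ← WithTop.coe_zero, WithTop.coe_le_coe]

end realVal

/-! ### Extension of a real valuation to an algebraic extension -/

section Extension

variable {K L : Type*} [Field K] [Field L] [Algebra K L]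

/-- Two terms of an algebraic equation for `y` must have the same value, so that some power of `y`
has the value of an element of the base field. -/
theorem exists_pow_valuation_eq {Γ : Type*} [LinearOrderedCommGroupWithZero Γ] (w : Valuation L Γ)
    {y : L} (hy : y ≠ 0) (halg : IsAlgebraic K y) :
    ∃ n : ℕ, 0 < n ∧ ∃ a : K, a ≠ 0 ∧ w y ^ n = w (algebraMap K L a) := by
  classical
  obtain ⟨p, hp, hpy⟩ := halg
  have hwy : w y ≠ 0 := (w.ne_zero_iff).2 hy
  have main : ∃ i ∈ p.support, ∃ j ∈ p.support, i < j ∧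
      w (algebraMap K L (p.coeff i) * y ^ i) = w (algebraMap K L (p.coeff j) * y ^ j) := by
    obtain ⟨j, hj, hmax⟩ := p.support.exists_max_image
      (fun i => w (algebraMap K L (p.coeff i) * y ^ i)) (by simpa using hp)
    by_contra! hne
    have hsum := w.map_sum_eq_of_lt (f := fun i => algebraMap K L (p.coeff i) * y ^ i) hj
      (fun i hi => by
        simp only [Finset.mem_sdiff, Finset.mem_singleton] at hi
        refine lt_of_le_of_ne (hmax i hi.1) ?_
        rcases lt_or_gt_of_ne hi.2 with h | h
        · exact hne i hi.1 j hj h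
        · exact (hne j hj i hi.1 h).symm)
    rw [aeval_eq_sum_range, ← sum_over_range' (f := fun i a => a • y ^ i) p (by simp) _
      (Nat.lt_succ_self _)] at hpy
    simp only [Polynomial.sum, Algebra.smul_def] at hpy
    rw [hpy, map_zero] at hsum
    have : algebraMap K L (p.coeff j) * y ^ j ≠ 0 :=
      mul_ne_zero (by simpa using hj) (pow_ne_zero _ hy)
    exact this ((w.zero_iff).1 hsum.symm)
  obtain ⟨i, hi, j, hj, hij, h⟩ := main
  rw [mem_support_iff] at hi hj
  have hwj : w (algebraMap K L (p.coeff j)) ≠ 0 := (w.ne_zero_iff).2 (by simpa using hj)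
  refine ⟨j - i, by omega, p.coeff i / p.coeff j, div_ne_zero hi hj, ?_⟩
  rw [map_div₀, map_div₀, eq_div_iff hwj]
  rw [map_mul, map_mul, map_pow, map_pow] at h
  refine mul_right_cancel₀ (pow_ne_zero i hwy) ?_
  rw [h, mul_right_comm, ← pow_add, Nat.sub_add_cancel hij.le, mul_comm]

/-- Every real valuation extends to an algebraic extension, and the values of the extension are
torsion over the value group. A valuation ring `W` dominating that of `v` need not be handled
through its own value group: the value of `y` is `v a / n`, where `y ^ n` and `a ∈ K` have the same
value for `W`. -/
theorem exists_addValuation_extension [Algebra.IsAlgebraic K L] (v : AddValuation K (WithTop ℝ)) :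
    ∃ u : AddValuation L (WithTop ℝ), (∀ x : K, u (algebraMap K L x) = v x) ∧
      ∀ y : L, y ≠ 0 → ∃ n : ℕ, 0 < n ∧ ∃ a : K, a ≠ 0 ∧ n * realVal u y = realVal v a := by
  classical
  obtain ⟨W, hW, hloc⟩ := IsLocalRing.exists_factor_valuationRing
    ((algebraMap K L).comp (addValuationRing v).subtype)
  have hWV : ∀ x : K, algebraMap K L x ∈ W ↔ 0 ≤ v x := by
    refine fun x => ⟨fun hx => ?_, fun hx => hW ⟨x, hx⟩⟩
    by_contra! hlt
    have hx0 : x ≠ 0 := by rintro rfl; simp at hlt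
    have hinv : 0 ≤ v x⁻¹ := by
      rw [zero_le_map_iff v (inv_ne_zero hx0), realVal_inv v hx0]
      rw [← not_le, zero_le_map_iff v hx0] at hlt
      linarith
    have hu : IsUnit (⟨x⁻¹, hinv⟩ : addValuationRing v) := by
      refine hloc.map_nonunit _ (IsUnit.of_mul_eq_one ⟨algebraMap K L x, hx⟩ (Subtype.ext ?_))
      change algebraMap K L x⁻¹ * algebraMap K L x = 1
      rw [← map_mul, inv_mul_cancel₀ hx0, map_one]
    obtain ⟨b, hb⟩ := hu.exists_right_inv
    have hb' : x⁻¹ * (b : K) = 1 := congrArg Subtype.val hb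
    have : (b : K) = x := by field_simp at hb'; exact hb'
    exact absurd (this ▸ b.2 : x ∈ addValuationRing v) (not_le.2 hlt)
  have hex : ∀ y : L, y ≠ 0 → ∃ q : ℝ, ∃ n : ℕ, 0 < n ∧ ∃ a : K, a ≠ 0 ∧
      W.valuation y ^ n = W.valuation (algebraMap K L a) ∧ n * q = realVal v a := by
    intro y hy
    obtain ⟨n, hn, a, ha, h⟩ := exists_pow_valuation_eq (K := K) W.valuation hy
      (Algebra.IsAlgebraic.isAlgebraic y)
    exact ⟨realVal v a / n, n, hn, a, ha, h, by field_simp⟩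
  choose! r hr using hex
  -- The value `q` is determined by `y` and depends monotonically on the valuation of `y` for `W`:
  -- compare the powers of exponent `n * m`, whose values come from `K`, where `W` restricts to `v`.
  have hmono : ∀ x y : L, ∀ p q : ℝ,
      (∃ n : ℕ, 0 < n ∧ ∃ a : K, a ≠ 0 ∧
        W.valuation x ^ n = W.valuation (algebraMap K L a) ∧ n * q = realVal v a) →
      (∃ n : ℕ, 0 < n ∧ ∃ a : K, a ≠ 0 ∧
        W.valuation y ^ n = W.valuation (algebraMap K L a) ∧ n * p = realVal v a) →
      W.valuation x ≤ W.valuation y → p ≤ q := by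
    rintro x y p q ⟨n, hn, a, ha, hxa, hq⟩ ⟨m, hm, b, hb, hyb, hp⟩ hle
    have h1 : W.valuation (algebraMap K L (a ^ m / b ^ n)) ≤ 1 := by
      rw [map_div₀, map_div₀, map_pow, map_pow, map_pow, map_pow, ← hxa, ← hyb, ← pow_mul,
        ← pow_mul, mul_comm m n]
      exact div_le_one_of_le₀ (pow_le_pow_left₀ zero_le hle _) zero_le
    rw [W.valuation_le_one_iff, hWV, zero_le_map_iff v
      (div_ne_zero (pow_ne_zero _ ha) (pow_ne_zero _ hb)), realVal_div v (pow_ne_zero _ ha)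
      (pow_ne_zero _ hb), realVal_pow v ha, realVal_pow v hb, ← hq, ← hp] at h1
    have hpos : (0 : ℝ) < m * n := by positivity
    refine le_of_mul_le_mul_left ?_ hpos
    linarith
  have huniq : ∀ y : L, ∀ q : ℝ, y ≠ 0 → (∃ n : ℕ, 0 < n ∧ ∃ a : K, a ≠ 0 ∧
        W.valuation y ^ n = W.valuation (algebraMap K L a) ∧ n * q = realVal v a) → r y = q :=
    fun y q hy h => le_antisymm (hmono y y _ _ h (hr y hy) le_rfl) (hmono y y _ _ (hr y hy) h le_rfl)
  have hbase : ∀ x : K, x ≠ 0 → r (algebraMap K L x) = realVal v x := fun x hx =>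
    huniq _ _ (by simpa using hx) ⟨1, one_pos, x, hx, by simp, by simp⟩
  have hmul : ∀ x y : L, x ≠ 0 → y ≠ 0 → r (x * y) = r x + r y := by
    intro x y hx hy
    obtain ⟨n, hn, a, ha, h1, h2⟩ := hr x hx
    obtain ⟨m, hm, b, hb, h3, h4⟩ := hr y hy
    refine huniq _ _ (mul_ne_zero hx hy) ⟨n * m, by positivity, a ^ m * b ^ n,
      mul_ne_zero (pow_ne_zero _ ha) (pow_ne_zero _ hb), ?_, ?_⟩
    · simp only [map_mul, map_pow, mul_pow, ← h1, ← h3, ← pow_mul]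
      rw [mul_comm m n]
    · rw [realVal_mul v (pow_ne_zero _ ha) (pow_ne_zero _ hb), realVal_pow v ha, realVal_pow v hb,
        ← h2, ← h4]
      push_cast; ring
  have hle : ∀ x y : L, x ≠ 0 → y ≠ 0 → W.valuation x ≤ W.valuation y → r y ≤ r x :=
    fun x y hx hy h => hmono x y _ _ (hr x hx) (hr y hy) h
  let f : L → WithTop ℝ := fun y => if y = 0 then ⊤ else (r y : WithTop ℝ)
  have hf : ∀ y, y ≠ 0 → f y = (r y : WithTop ℝ) := fun y hy => if_neg hy
  have hf0 : f 0 = ⊤ := if_pos rfl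
  let u : AddValuation L (WithTop ℝ) := AddValuation.of f hf0
    (by
      rw [hf 1 one_ne_zero, ← map_one (algebraMap K L), hbase 1 one_ne_zero, realVal_one]; rfl)
    (by
      intro x y
      by_cases hx : x = 0
      · simp [hx]
      by_cases hy : y = 0
      · simp [hy]
      by_cases hxy : x + y = 0
      · rw [hxy, hf0]; exact le_top
      rw [hf x hx, hf y hy, hf _ hxy]
      rcases le_max_iff.1 (W.valuation.map_add x y) with h | h
      · exact (min_le_left _ _).trans (WithTop.coe_le_coe.2 (hle _ _ hxy hx h))
      · exact (min_le_right _ _).trans (WithTop.coe_le_coe.2 (hle _ _ hxy hy h)))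
    (by
      intro x y
      by_cases hx : x = 0
      · simp [hx, hf0]
      by_cases hy : y = 0
      · simp [hy, hf0]
      rw [hf x hx, hf y hy, hf _ (mul_ne_zero hx hy), hmul x y hx hy, WithTop.coe_add])
  have hu : ∀ y, y ≠ 0 → u y = (r y : WithTop ℝ) := hf
  refine ⟨u, fun x => ?_, fun y hy => ?_⟩
  · by_cases hx : x = 0
    · simp [hx]
    · rw [hu _ (by simpa using hx), hbase x hx, coe_realVal v hx]
  · obtain ⟨n, hn, a, ha, -, h⟩ := hr y hy
    exact ⟨n, hn, a, ha, by rw [realVal_eq u (hu y hy), h]⟩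

end Extension

/-! ### Values of rational functions along a pseudo-convergent sequence -/

section RatEval

variable {K : Type*} [Field K]

/-- A property of sequences that holds for nonzero constants and for `n ↦ s n - β`, and that is
stable under products and inverses, holds along `s` for all nonzero rational functions: these
split into linear factors over an algebraically closed field. -/
theorem ratEval_induction {L : Type*} [Field L] [Algebra K L] [IsAlgClosed L] {s : ℕ → K}
    {P : (ℕ → L) → Prop} (hconst : ∀ b : L, b ≠ 0 → P (fun _ => b))
    (hlin : ∀ β : L, P (fun n => algebraMap K L (s n) - β))
    (hmul : ∀ t t' : ℕ → L, P t → P t' → P (fun n => t n * t' n))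
    (hinv : ∀ t : ℕ → L, P t → P (fun n => (t n)⁻¹)) {φ : RatFunc K} (hφ : φ ≠ 0) :
    P (fun n => algebraMap K L (ratEval φ (s n))) := by
  have hprod : ∀ m : Multiset L,
      P (fun n => (m.map (fun β => algebraMap K L (s n) - β)).prod) := by
    intro m
    induction m using Multiset.induction_on with
    | empty => simpa using hconst 1 one_ne_zero
    | cons β m ih => simpa using hmul _ _ (hlin β) ih
  have hpoly : ∀ f : K[X], f ≠ 0 → P (fun n => algebraMap K L (f.eval (s n))) := by
    intro f hf
    have h1 := (IsAlgClosed.splits (f.map (algebraMap K L))).eq_prod_roots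
    have h2 : ∀ n, algebraMap K L (f.eval (s n)) = (f.map (algebraMap K L)).leadingCoeff *
        ((f.map (algebraMap K L)).roots.map (fun β => algebraMap K L (s n) - β)).prod := by
      intro n
      rw [← eval_map_apply, h1, eval_mul, eval_C, eval_multiset_prod, Multiset.map_map, ← h1]
      simp
    simp only [h2]
    exact hmul _ _ (hconst _ (by simpa using hf)) (hprod _)
  have h3 : ∀ n, algebraMap K L (ratEval φ (s n)) =
      algebraMap K L (φ.num.eval (s n)) * (algebraMap K L (φ.denom.eval (s n)))⁻¹ := by
    intro n
    rw [ratEval, RatFunc.eval, map_div₀, div_eq_mul_inv]; rfl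
  simp only [h3]
  exact hmul _ _ (hpoly _ (RatFunc.num_ne_zero hφ)) (hinv _ (hpoly _ φ.denom_ne_zero))

theorem ratEval_add {φ ψ : RatFunc K} {a : K} (h : φ.denom.eval a ≠ 0) (h' : ψ.denom.eval a ≠ 0) :
    ratEval (φ + ψ) a = ratEval φ a + ratEval ψ a :=
  RatFunc.eval_add (RingHom.id K) a h h'

theorem ratEval_mul {φ ψ : RatFunc K} {a : K} (h : φ.denom.eval a ≠ 0) (h' : ψ.denom.eval a ≠ 0) :
    ratEval (φ * ψ) a = ratEval φ a * ratEval ψ a :=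
  RatFunc.eval_mul (RingHom.id K) a h h'

theorem ratEval_algebraMap (f : K[X]) (a : K) :
    ratEval (algebraMap K[X] (RatFunc K) f) a = f.eval a := by
  simp [ratEval, RatFunc.eval, eval₂_id]

theorem ratEval_C (c a : K) : ratEval (RatFunc.C c) a = c := by
  simp [ratEval]

theorem eventually_eval_ne_zero {s : ℕ → K} (hinj : Function.Injective s) {f : K[X]} (hf : f ≠ 0) :
    ∀ᶠ n in atTop, f.eval (s n) ≠ 0 := by
  classical
  have h := hinj.tendsto_cofinite.eventually (f.roots.toFinset.finite_toSet.compl_mem_cofinite)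
  rw [Nat.cofinite_eq_atTop] at h
  filter_upwards [h] with n hn
  simpa [hf] using hn

theorem eventually_denom_ne_zero {s : ℕ → K} (hinj : Function.Injective s) (φ : RatFunc K) :
    ∀ᶠ n in atTop, φ.denom.eval (s n) ≠ 0 :=
  eventually_eval_ne_zero hinj φ.denom_ne_zero

theorem eventually_ratEval_add {s : ℕ → K} (hinj : Function.Injective s) (φ ψ : RatFunc K) :
    ∀ᶠ n in atTop, ratEval (φ + ψ) (s n) = ratEval φ (s n) + ratEval ψ (s n) := by
  filter_upwards [eventually_denom_ne_zero hinj φ, eventually_denom_ne_zero hinj ψ] with n h h'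
  exact ratEval_add h h'

theorem eventually_ratEval_mul {s : ℕ → K} (hinj : Function.Injective s) (φ ψ : RatFunc K) :
    ∀ᶠ n in atTop, ratEval (φ * ψ) (s n) = ratEval φ (s n) * ratEval ψ (s n) := by
  filter_upwards [eventually_denom_ne_zero hinj φ, eventually_denom_ne_zero hinj ψ] with n h h'
  exact ratEval_mul h h'

theorem eventually_ratEval_ne_zero {s : ℕ → K} (hinj : Function.Injective s) {φ : RatFunc K}
    (hφ : φ ≠ 0) : ∀ᶠ n in atTop, ratEval φ (s n) ≠ 0 := by
  filter_upwards [eventually_eval_ne_zero hinj (RatFunc.num_ne_zero hφ),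
    eventually_denom_ne_zero hinj φ] with n h h'
  exact div_ne_zero (by simpa [eval₂_id] using h) (by simpa [eval₂_id] using h')

end RatEval

/-- The gauge `v (s (n + 1) - s n)` of a pseudo-convergent sequence, as a real number. -/
noncomputable def seqGauge {K : Type*} [Field K] (v : AddValuation K (WithTop ℝ)) (s : ℕ → K)
    (n : ℕ) : ℝ := realVal v (s (n + 1) - s n)

namespace IsPseudoConvergent

variable {K : Type*} [Field K] {v : AddValuation K (WithTop ℝ)} {s : ℕ → K}

theorem map_succ_sub (hs : IsPseudoConvergent v s) (n : ℕ) :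
    v (s (n + 1) - s n) = ((seqGauge v s n : ℝ) : WithTop ℝ) :=
  (coe_realVal v ((v.ne_top_iff).1 (ne_top_of_lt (hs n)))).symm

theorem strictMono_seqGauge (hs : IsPseudoConvergent v s) : StrictMono (seqGauge v s) :=
  strictMono_nat_of_lt_succ fun n => by
    have := hs n
    rwa [hs.map_succ_sub, hs.map_succ_sub (n + 1), WithTop.coe_lt_coe] at this

theorem map_sub (hs : IsPseudoConvergent v s) {m n : ℕ} (h : m < n) :
    v (s n - s m) = ((seqGauge v s m : ℝ) : WithTop ℝ) := by
  induction n, h using Nat.le_induction with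
  | base => exact hs.map_succ_sub m
  | succ n hmn ih =>
    rw [← sub_add_sub_cancel (s (n + 1)) (s n) (s m), v.map_add_eq_of_lt_right, ih]
    rw [ih, hs.map_succ_sub, WithTop.coe_lt_coe]
    exact hs.strictMono_seqGauge (by omega)

theorem injective (hs : IsPseudoConvergent v s) : Function.Injective s := by
  have key : ∀ m n, m < n → s m ≠ s n := fun m n h h' => by
    have := hs.map_sub h
    rw [h', sub_self, v.map_zero] at this
    exact WithTop.top_ne_coe this
  intro m n h
  by_contra hne
  rcases lt_or_gt_of_ne hne with h' | h'
  · exact key _ _ h' h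
  · exact key _ _ h' h.symm

variable {L : Type*} [Field L] [Algebra K L] {u : AddValuation L (WithTop ℝ)}

/-- An element `β` of an extension either is a pseudo-limit, or its distance to `s n` is eventually
constant and smaller than the gauge. -/
theorem map_sub_or (hs : IsPseudoConvergent v s) (hu : ∀ x, u (algebraMap K L x) = v x) (β : L) :
    (∀ n, u (algebraMap K L (s n) - β) = ((seqGauge v s n : ℝ) : WithTop ℝ)) ∨
    ∃ m, u (algebraMap K L (s m) - β) < ((seqGauge v s m : ℝ) : WithTop ℝ) ∧
      ∀ n, m ≤ n → u (algebraMap K L (s n) - β) = u (algebraMap K L (s m) - β) := by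
  by_cases h : ∃ m, u (algebraMap K L (s m) - β) < ((seqGauge v s m : ℝ) : WithTop ℝ)
  · obtain ⟨m, hm⟩ := h
    refine Or.inr ⟨m, hm, fun n hn => ?_⟩
    rcases hn.eq_or_lt with rfl | hn
    · rfl
    rw [← sub_add_sub_cancel _ (algebraMap K L (s m)) β, u.map_add_eq_of_lt_right]
    rwa [← _root_.map_sub, hu, hs.map_sub hn]
  · push Not at h
    refine Or.inl fun n => ?_
    have h1 : u (algebraMap K L (s (n + 1)) - algebraMap K L (s n)) = (seqGauge v s n : ℝ) := by
      rw [← _root_.map_sub, hu, hs.map_succ_sub]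
    have h2 : algebraMap K L (s n) - β = (algebraMap K L (s (n + 1)) - β) -
        (algebraMap K L (s (n + 1)) - algebraMap K L (s n)) := by ring
    rw [h2, u.map_sub_eq_of_lt_right, h1]
    rw [h1]
    exact lt_of_lt_of_le (WithTop.coe_lt_coe.2 (hs.strictMono_seqGauge (Nat.lt_succ_self n)))
      (h (n + 1))

/-- Along a pseudo-convergent sequence with gauge `γ`, the value of a nonzero rational function is
eventually `c + k γ n` for an integer `k` and a real `c` that is torsion over the value group. -/
theorem exists_eventually_map_ratEval (hs : IsPseudoConvergent v s) {φ : RatFunc K} (hφ : φ ≠ 0) :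
    ∃ c : ℝ, ∃ k : ℤ, (∃ N : ℕ, 0 < N ∧ ∃ a : K, a ≠ 0 ∧ N * c = realVal v a) ∧
      ∀ᶠ n in atTop, v (ratEval φ (s n)) = ((c + k * seqGauge v s n : ℝ) : WithTop ℝ) := by
  obtain ⟨u, hu, htors⟩ := exists_addValuation_extension (L := AlgebraicClosure K) v
  have main := ratEval_induction (L := AlgebraicClosure K) (s := s)
    (P := fun t => ∃ b : AlgebraicClosure K, b ≠ 0 ∧ ∃ k : ℤ, ∀ᶠ n in atTop,
      u (t n) = ((realVal u b + k * seqGauge v s n : ℝ) : WithTop ℝ))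
    (fun b hb => ⟨b, hb, 0, by simp [coe_realVal u hb]⟩)
    (fun β => by
      rcases hs.map_sub_or hu β with h | ⟨m, hm, h⟩
      · exact ⟨1, one_ne_zero, 1, by simp [h, realVal_one]⟩
      · have hb : algebraMap K (AlgebraicClosure K) (s m) - β ≠ 0 :=
          (u.ne_top_iff).1 (ne_top_of_lt hm)
        refine ⟨_, hb, 0, ?_⟩
        filter_upwards [eventually_ge_atTop m] with n hn
        simp [h n hn, coe_realVal u hb])
    (fun t t' ⟨b, hb, k, h⟩ ⟨b', hb', k', h'⟩ => by
      refine ⟨b * b', mul_ne_zero hb hb', k + k', ?_⟩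
      filter_upwards [h, h'] with n h h'
      rw [u.map_mul, h, h', ← WithTop.coe_add, realVal_mul u hb hb']
      refine congrArg _ ?_
      push_cast
      ring)
    (fun t ⟨b, hb, k, h⟩ => by
      refine ⟨b⁻¹, inv_ne_zero hb, -k, ?_⟩
      filter_upwards [h] with n h
      have ht := ne_zero_of_map_eq_coe u h
      rw [← coe_realVal u (inv_ne_zero ht), realVal_inv u ht, realVal_inv u hb, realVal_eq u h]
      refine congrArg _ ?_
      push_cast
      ring) hφ
  obtain ⟨b, hb, k, h⟩ := main
  refine ⟨realVal u b, k, htors b hb, ?_⟩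
  simpa only [hu] using h

/-- Along a pseudo-convergent sequence, a rational function eventually has nonnegative values or
eventually has negative values. -/
theorem eventually_nonneg_or_neg (hs : IsPseudoConvergent v s) (φ : RatFunc K) :
    (∀ᶠ n in atTop, 0 ≤ v (ratEval φ (s n))) ∨ ∀ᶠ n in atTop, v (ratEval φ (s n)) < 0 := by
  by_cases hφ : φ = 0
  · left; simp [hφ, ratEval]
  obtain ⟨c, k, -, h⟩ := hs.exists_eventually_map_ratEval hφ
  -- `γ` is increasing, so the sign of `k` makes `c + k γ n` monotone or antitone in `n`.
  have hmon : (∀ᶠ n in atTop, 0 ≤ c + k * seqGauge v s n) ∨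
      ∀ᶠ n in atTop, c + k * seqGauge v s n < 0 := by
    rcases le_total 0 k with hk | hk
    · by_cases hex : ∃ m, 0 ≤ c + k * seqGauge v s m
      · obtain ⟨m, hm⟩ := hex
        left
        filter_upwards [eventually_ge_atTop m] with n hn
        have := mul_le_mul_of_nonneg_left (hs.strictMono_seqGauge.monotone hn)
          (by exact_mod_cast hk : (0 : ℝ) ≤ k)
        linarith
      · push Not at hex
        exact Or.inr (Eventually.of_forall hex)
    · by_cases hex : ∃ m, c + k * seqGauge v s m < 0
      · obtain ⟨m, hm⟩ := hex
        right
        filter_upwards [eventually_ge_atTop m] with n hn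
        have := mul_le_mul_of_nonpos_left (hs.strictMono_seqGauge.monotone hn)
          (by exact_mod_cast hk : (k : ℝ) ≤ 0)
        linarith
      · push Not at hex
        exact Or.inl (Eventually.of_forall hex)
  refine hmon.imp (fun h' => ?_) (fun h' => ?_) <;> filter_upwards [h, h'] with n h h' <;> rw [h]
  · exact_mod_cast h'
  · exact_mod_cast h'

variable {V : ValuationSubring K}

theorem mem_ringVE_iff (hs : IsPseudoConvergent v s) (hv : ∀ x : K, x ∈ V ↔ 0 ≤ v x)
    {φ : RatFunc K} : φ ∈ ringVE V s ↔ ∀ᶠ n in atTop, 0 ≤ v (ratEval φ (s n)) := by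
  change (∀ᶠ n in atTop, φ.denom.eval (s n) ≠ 0 ∧ ratEval φ (s n) ∈ V) ↔ _
  simp only [hv, eventually_and, eventually_denom_ne_zero hs.injective φ, true_and]

theorem notMem_ringVE_iff (hs : IsPseudoConvergent v s) (hv : ∀ x : K, x ∈ V ↔ 0 ≤ v x)
    {φ : RatFunc K} : φ ∉ ringVE V s ↔ ∀ᶠ n in atTop, v (ratEval φ (s n)) < 0 := by
  rw [hs.mem_ringVE_iff hv]
  refine ⟨(hs.eventually_nonneg_or_neg φ).resolve_left, fun h h' => ?_⟩
  obtain ⟨n, hn, hn'⟩ := (h.and h').exists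
  exact hn'.not_gt hn

theorem mem_or_inv_mem_ringVE (hs : IsPseudoConvergent v s) (hv : ∀ x : K, x ∈ V ↔ 0 ≤ v x)
    (φ : RatFunc K) : φ ∈ ringVE V s ∨ φ⁻¹ ∈ ringVE V s := by
  by_cases hφ : φ = 0
  · exact Or.inl (hφ ▸ (ringVE V s).zero_mem)
  refine or_iff_not_imp_left.2 fun h => ?_
  rw [hs.notMem_ringVE_iff hv] at h
  rw [hs.mem_ringVE_iff hv]
  filter_upwards [h, eventually_ratEval_mul hs.injective φ φ⁻¹] with n hn hmul
  rw [mul_inv_cancel₀ hφ] at hmul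
  have h1 : ratEval (1 : RatFunc K) (s n) = 1 := by simp [ratEval]
  rw [h1] at hmul
  have hx : ratEval φ (s n) ≠ 0 := left_ne_zero_of_mul_eq_one hmul.symm
  rw [eq_inv_of_mul_eq_one_right hmul.symm, zero_le_map_iff v (inv_ne_zero hx), realVal_inv v hx]
  rw [← not_le, zero_le_map_iff v hx] at hn
  linarith

end IsPseudoConvergent

/-! ### The rank of a valuation ring in terms of its overrings -/

namespace ValuationSubring

variable {F : Type*} [Field F] (A : ValuationSubring F)

theorem ringKrullDim_eq_krullDim_overrings :
    ringKrullDim A = Order.krullDim {S : ValuationSubring F // A ≤ S} := by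
  rw [ringKrullDim, ← Order.krullDim_orderDual]
  exact Order.krullDim_eq_of_orderIso A.primeSpectrumOrderEquiv

theorem ringKrullDim_top : ringKrullDim (⊤ : ValuationSubring F) = 0 :=
  ringKrullDim_eq_zero_of_field _

theorem ringKrullDim_eq_one (htop : A ≠ ⊤) (h : ∀ B, A ≤ B → B = A ∨ B = ⊤) :
    ringKrullDim A = 1 := by
  rw [ringKrullDim_eq_krullDim_overrings]
  let _ : BoundedOrder {S : ValuationSubring F // A ≤ S} :=
    { top := ⟨⊤, A.le_top⟩, bot := ⟨A, le_rfl⟩, le_top := fun x => x.1.le_top,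
      bot_le := fun x => x.2 }
  have : IsSimpleOrder {S : ValuationSubring F // A ≤ S} :=
    { exists_pair_ne := ⟨⟨A, le_rfl⟩, ⟨⊤, A.le_top⟩, fun h => htop (congrArg Subtype.val h)⟩
      eq_bot_or_eq_top := fun x => (h x.1 x.2).imp Subtype.ext Subtype.ext }
  exact Order.krullDim_of_isSimpleOrder

theorem eq_or_eq_top_of_ringKrullDim_eq_one (hA : ringKrullDim A = 1) {B : ValuationSubring F}
    (h : A ≤ B) : B = A ∨ B = ⊤ := by
  have : Ring.KrullDimLE 1 A := Ring.krullDimLE_iff.2 (by simp [hA])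
  exact (A.eq_self_or_eq_top_of_le h).imp Eq.symm id

theorem ne_top_of_ringKrullDim_eq_one (hA : ringKrullDim A = 1) : A ≠ ⊤ := by
  rintro rfl
  rw [ringKrullDim_top] at hA
  exact zero_ne_one hA

/-- A valuation ring has rank two if it has exactly one overring strictly between itself and the
field. -/
theorem ringKrullDim_eq_two {B : ValuationSubring F} (hAB : A < B) (hB : B < ⊤)
    (h : ∀ C, A ≤ C → C = A ∨ C = B ∨ C = ⊤) : ringKrullDim A = 2 := by
  rw [ringKrullDim_eq_krullDim_overrings]
  let f : Fin 3 → {S : ValuationSubring F // A ≤ S} := ![⟨A, le_rfl⟩, ⟨B, hAB.le⟩, ⟨⊤, A.le_top⟩]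
  have hf : Function.Surjective f := by
    rintro ⟨C, hC⟩
    rcases h C hC with rfl | rfl | rfl
    · exact ⟨0, rfl⟩
    · exact ⟨1, rfl⟩
    · exact ⟨2, rfl⟩
  have hmono : StrictMono f := by
    refine Fin.strictMono_iff_lt_succ.2 fun i => ?_
    fin_cases i
    · exact hAB
    · exact hB
  refine le_antisymm ?_ ?_
  · refine iSup_le fun l => ?_
    classical
    let _ := Fintype.ofSurjective f hf
    have h3 : l.length < 3 := l.length_lt_card.trans_le (by
      simpa using Fintype.card_le_of_surjective f hf)
    exact_mod_cast Nat.le_of_lt_succ h3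
  · exact Order.LTSeries.length_le_krullDim (LTSeries.mk 2 f hmono)

end ValuationSubring

theorem ringKrullDim_subring_eq {F : Type*} [Field F] {R : Subring F} {A : ValuationSubring F}
    (h : R = A.toSubring) : ringKrullDim R = ringKrullDim A := by
  subst h; rfl

/-- The ring of a nontrivial real valuation is one-dimensional, because `ℝ` is archimedean. -/
theorem ringKrullDim_addValuationRing {F : Type*} [Field F] (w : AddValuation F (WithTop ℝ))
    {x : F} (hx : w x < 0) : ringKrullDim (addValuationRing w) = 1 := by
  have hmem : ∀ y, y ∈ addValuationRing w ↔ 0 ≤ w y := fun y => Iff.rfl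
  refine ValuationSubring.ringKrullDim_eq_one _ ?_ fun B hB => or_iff_not_imp_left.2 fun hne => ?_
  · intro h
    have : x ∈ addValuationRing w := h ▸ ValuationSubring.mem_top x
    exact hx.not_ge this
  · obtain ⟨y, hyB, hy⟩ := SetLike.exists_of_lt (lt_of_le_of_ne hB (Ne.symm hne))
    have hy0 : y ≠ 0 := by rintro rfl; exact hy (ValuationSubring.zero_mem _)
    rw [hmem, zero_le_map_iff w hy0, not_le] at hy
    refine eq_top_iff.2 fun z _ => ?_
    by_cases hz : z = 0
    · exact hz ▸ B.zero_mem
    obtain ⟨n, hn⟩ := Archimedean.arch (- realVal w z) (neg_pos.2 hy)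
    have hmz : z / y ^ n ∈ addValuationRing w := by
      rw [hmem, zero_le_map_iff w (div_ne_zero hz (pow_ne_zero n hy0)),
        realVal_div w hz (pow_ne_zero n hy0), realVal_pow w hy0]
      rw [nsmul_eq_mul] at hn
      linarith
    have := B.mul_mem _ _ (hB hmz) (pow_mem hyB n)
    rwa [div_mul_cancel₀ _ (pow_ne_zero n hy0)] at this

/-! ### The limit valuation -/

section Limit

variable {K : Type*} [Field K] {v : AddValuation K (WithTop ℝ)} {s : ℕ → K}

/-- If the values of every nonzero rational function converge to a real number along `s`, the limit
is a valuation. -/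
theorem exists_isOstrowskiValuation (hinj : Function.Injective s)
    (h : ∀ φ : RatFunc K, φ ≠ 0 →
      ∃ l : ℝ, Tendsto (fun n => realVal v (ratEval φ (s n))) atTop (𝓝 l)) :
    ∃ w : AddValuation (RatFunc K) (WithTop ℝ), IsOstrowskiValuation v s w := by
  classical
  choose! r hr using h
  have hadd : ∀ φ ψ : RatFunc K, φ ≠ 0 → ψ ≠ 0 → φ + ψ ≠ 0 → min (r φ) (r ψ) ≤ r (φ + ψ) := by
    intro φ ψ hφ hψ hs
    refine le_of_tendsto_of_tendsto ((hr φ hφ).min (hr ψ hψ)) (hr _ hs) ?_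
    filter_upwards [eventually_ratEval_add hinj φ ψ, eventually_ratEval_ne_zero hinj hφ,
      eventually_ratEval_ne_zero hinj hψ, eventually_ratEval_ne_zero hinj hs] with n h1 h2 h3 h4
    have := v.map_add (ratEval φ (s n)) (ratEval ψ (s n))
    rw [h1] at h4 ⊢
    rw [← coe_realVal v h2, ← coe_realVal v h3, ← coe_realVal v h4, ← WithTop.coe_min,
      WithTop.coe_le_coe] at this
    exact this
  have hmul : ∀ φ ψ : RatFunc K, φ ≠ 0 → ψ ≠ 0 → r (φ * ψ) = r φ + r ψ := by
    intro φ ψ hφ hψ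
    refine tendsto_nhds_unique (hr _ (mul_ne_zero hφ hψ)) (((hr φ hφ).add (hr ψ hψ)).congr' ?_)
    filter_upwards [eventually_ratEval_mul hinj φ ψ, eventually_ratEval_ne_zero hinj hφ,
      eventually_ratEval_ne_zero hinj hψ] with n h1 h2 h3
    rw [h1, realVal_mul v h2 h3]
  have hone : r 1 = 0 := by
    refine tendsto_nhds_unique (hr 1 one_ne_zero) ?_
    simp [ratEval, realVal_one]
  let f : RatFunc K → WithTop ℝ := fun y => if y = 0 then ⊤ else (r y : WithTop ℝ)
  have hf : ∀ y, y ≠ 0 → f y = (r y : WithTop ℝ) := fun y hy => if_neg hy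
  have hf0 : f 0 = ⊤ := if_pos rfl
  refine ⟨AddValuation.of f hf0 (by rw [hf 1 one_ne_zero, hone]; rfl) (fun x y => ?_)
    (fun x y => ?_), fun φ => ?_⟩
  · by_cases hx : x = 0
    · simp [hx]
    by_cases hy : y = 0
    · simp [hy]
    by_cases hxy : x + y = 0
    · rw [hxy, hf0]; exact le_top
    rw [hf x hx, hf y hy, hf _ hxy, ← WithTop.coe_min, WithTop.coe_le_coe]
    exact hadd x y hx hy hxy
  · by_cases hx : x = 0
    · simp [hx, hf0]
    by_cases hy : y = 0
    · simp [hy, hf0]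
    rw [hf x hx, hf y hy, hf _ (mul_ne_zero hx hy), hmul x y hx hy, WithTop.coe_add]
  · rw [AddValuation.of_apply]
    by_cases hφ : φ = 0
    · simp [hφ, hf0, ratEval]
    rw [hf φ hφ]
    refine ((WithTop.continuous_coe.tendsto _).comp (hr φ hφ)).congr' ?_
    filter_upwards [eventually_ratEval_ne_zero hinj hφ] with n hn
    exact coe_realVal v hn

theorem IsOstrowskiValuation.map_C {w : AddValuation (RatFunc K) (WithTop ℝ)}
    (hw : IsOstrowskiValuation v s w) (c : K) : w (RatFunc.C c) = v c := by
  have := hw (RatFunc.C c)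
  simp only [ratEval_C] at this
  exact tendsto_nhds_unique this tendsto_const_nhds

theorem IsOstrowskiValuation.ringVE_le {w : AddValuation (RatFunc K) (WithTop ℝ)}
    (hw : IsOstrowskiValuation v s w) {V : ValuationSubring K} (hs : IsPseudoConvergent v s)
    (hv : ∀ x : K, x ∈ V ↔ 0 ≤ v x) : ringVE V s ≤ (addValuationRing w).toSubring := by
  intro φ hφ
  exact ge_of_tendsto (hw φ) ((hs.mem_ringVE_iff hv).1 hφ)

theorem exists_map_neg_of_ringKrullDim {V : ValuationSubring K} (hV : ringKrullDim V = 1)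
    (hv : ∀ x : K, x ∈ V ↔ 0 ≤ v x) : ∃ x : K, x ≠ 0 ∧ v x < 0 := by
  by_contra! h
  refine V.ne_top_of_ringKrullDim_eq_one hV (eq_top_iff.2 fun x _ => (hv x).2 ?_)
  by_cases hx : x = 0
  · simp [hx]
  · exact h x hx

/-! ### Sequences of transcendental type -/

/-- For transcendental type, values along the sequence are eventually equal to their limit, so they
are eventually nonnegative as soon as the limit is. -/
theorem exists_isOstrowskiValuation_of_isTranscendentalType {V : ValuationSubring K}
    (hV : ringKrullDim V = 1) (hv : ∀ x : K, x ∈ V ↔ 0 ≤ v x) (hs : IsPseudoConvergent v s)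
    (htr : IsTranscendentalType v s) :
    ∃ w : AddValuation (RatFunc K) (WithTop ℝ), IsOstrowskiValuation v s w ∧
      ringVE V s = (addValuationRing w).toSubring ∧ ringKrullDim (ringVE V s) = 1 := by
  have hpoly : ∀ f : K[X], f ≠ 0 → ∃ c : ℝ, ∀ᶠ n in atTop,
      realVal v (f.eval (s n)) = c := by
    intro f hf
    obtain ⟨c, hc⟩ := htr f
    refine ⟨c.untopD 0, ?_⟩
    filter_upwards [hc] with n hn
    rw [realVal, hn]
  have hconst : ∀ φ : RatFunc K, φ ≠ 0 → ∃ c : ℝ, ∀ᶠ n in atTop,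
      realVal v (ratEval φ (s n)) = c := by
    intro φ hφ
    obtain ⟨c, hc⟩ := hpoly _ (RatFunc.num_ne_zero hφ)
    obtain ⟨d, hd⟩ := hpoly _ φ.denom_ne_zero
    refine ⟨c - d, ?_⟩
    filter_upwards [hc, hd, eventually_eval_ne_zero hs.injective (RatFunc.num_ne_zero hφ),
      eventually_eval_ne_zero hs.injective φ.denom_ne_zero] with n h1 h2 h3 h4
    rw [← h1, ← h2, ← realVal_div v h3 h4]; rfl
  obtain ⟨w, hw⟩ := exists_isOstrowskiValuation hs.injective fun φ hφ => by
    obtain ⟨c, hc⟩ := hconst φ hφ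
    exact ⟨c, tendsto_const_nhds.congr' (hc.mono fun n h => h.symm)⟩
  have heq : ringVE V s = (addValuationRing w).toSubring := by
    refine le_antisymm (hw.ringVE_le hs hv) fun φ hφ => ?_
    by_cases h0 : φ = 0
    · exact h0 ▸ (ringVE V s).zero_mem
    obtain ⟨c, hc⟩ := hconst φ h0
    have hev : ∀ᶠ n in atTop, v (ratEval φ (s n)) = (c : WithTop ℝ) := by
      filter_upwards [hc, eventually_ratEval_ne_zero hs.injective h0] with n h1 h2
      rw [← h1, coe_realVal v h2]
    have hwc : w φ = (c : WithTop ℝ) :=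
      tendsto_nhds_unique (hw φ) (tendsto_const_nhds.congr' (hev.mono fun n h => h.symm))
    rw [hs.mem_ringVE_iff hv]
    filter_upwards [hev] with n h
    rw [h, ← hwc]
    exact hφ
  obtain ⟨x, -, hx⟩ := exists_map_neg_of_ringKrullDim hV hv
  refine ⟨w, hw, heq, (ringKrullDim_subring_eq heq).trans
    (ringKrullDim_addValuationRing w (x := RatFunc.C x) ?_)⟩
  rwa [hw.map_C]

end Limit

/-! ### Algebraic type with finite breadth: the limit valuation -/

section FiniteBreadth

variable {K : Type*} [Field K] {v : AddValuation K (WithTop ℝ)} {s : ℕ → K} {δ : ℝ}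

theorem HasBreadth.tendsto_seqGauge (hδ : HasBreadth v s (δ : WithTop ℝ))
    (hs : IsPseudoConvergent v s) : Tendsto (seqGauge v s) atTop (𝓝 δ) := by
  rw [WithTop.isEmbedding_coe.tendsto_nhds_iff]
  exact hδ.congr fun n => hs.map_succ_sub n

theorem HasBreadth.seqGauge_lt (hδ : HasBreadth v s (δ : WithTop ℝ))
    (hs : IsPseudoConvergent v s) (n : ℕ) : seqGauge v s n < δ :=
  (hs.strictMono_seqGauge (Nat.lt_succ_self n)).trans_le
    (hs.strictMono_seqGauge.monotone.ge_of_tendsto (hδ.tendsto_seqGauge hs) _)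

theorem HasBreadth.tendsto_affine (hδ : HasBreadth v s (δ : WithTop ℝ))
    (hs : IsPseudoConvergent v s) (c k : ℝ) :
    Tendsto (fun n => c + k * seqGauge v s n) atTop (𝓝 (c + k * δ)) :=
  ((hδ.tendsto_seqGauge hs).const_mul k).const_add c

theorem HasBreadth.exists_isOstrowskiValuation (hδ : HasBreadth v s (δ : WithTop ℝ))
    (hs : IsPseudoConvergent v s) :
    ∃ w : AddValuation (RatFunc K) (WithTop ℝ), IsOstrowskiValuation v s w :=
  _root_.exists_isOstrowskiValuation hs.injective fun φ hφ => by
    obtain ⟨c, k, -, h⟩ := hs.exists_eventually_map_ratEval hφ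
    refine ⟨c + k * δ, (hδ.tendsto_affine hs c k).congr' ?_⟩
    filter_upwards [h] with n hn
    exact (realVal_eq v hn).symm

variable {w : AddValuation (RatFunc K) (WithTop ℝ)}

theorem IsOstrowskiValuation.map_eq_of_eventually_affine (hw : IsOstrowskiValuation v s w)
    (hδ : HasBreadth v s (δ : WithTop ℝ)) (hs : IsPseudoConvergent v s) {φ : RatFunc K} {c k : ℝ}
    (h : ∀ᶠ n in atTop, v (ratEval φ (s n)) = ((c + k * seqGauge v s n : ℝ) : WithTop ℝ)) :
    w φ = ((c + k * δ : ℝ) : WithTop ℝ) :=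
  tendsto_nhds_unique (hw φ) (((WithTop.continuous_coe.tendsto _).comp
    (hδ.tendsto_affine hs c k)).congr' (h.mono fun _ h => h.symm))

/-- A torsion element and an integer multiple of a non-torsion one are independent. -/
theorem eq_zero_of_not_isTorsionOver (htor : ¬ IsTorsionOver v δ) {c : ℝ} {k : ℤ}
    (hc : ∃ N : ℕ, 0 < N ∧ ∃ a : K, a ≠ 0 ∧ N * c = realVal v a) (h : c + k * δ = 0) : k = 0 := by
  obtain ⟨N, hN, a, ha, hNa⟩ := hc
  by_contra hk
  rcases lt_or_gt_of_ne hk with hk | hk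
  · refine htor ⟨N * k.natAbs, by positivity, a, ?_⟩
    rw [← coe_realVal v ha, ← hNa]
    refine congrArg _ ?_
    have : ((k.natAbs : ℕ) : ℝ) = -k := by
      rw [Nat.cast_natAbs, abs_of_neg hk]; simp
    push_cast
    rw [this, mul_assoc]
    congr 1
    linarith
  · refine htor ⟨N * k.natAbs, by positivity, a⁻¹, ?_⟩
    rw [← coe_realVal v (inv_ne_zero ha), realVal_inv v ha, ← hNa]
    refine congrArg _ ?_
    have : ((k.natAbs : ℕ) : ℝ) = k := by
      rw [Nat.cast_natAbs, abs_of_pos hk]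
    push_cast
    rw [this, mul_assoc, ← mul_neg]
    congr 1
    linarith

/-- For non-torsion breadth, `w φ = c + k δ` vanishes only if `c = k = 0`, so the limit valuation
and the eventual behaviour along the sequence define the same ring. -/
theorem ringVE_eq_of_not_isTorsionOver {V : ValuationSubring K} (hv : ∀ x : K, x ∈ V ↔ 0 ≤ v x)
    (hw : IsOstrowskiValuation v s w) (hδ : HasBreadth v s (δ : WithTop ℝ))
    (hs : IsPseudoConvergent v s) (htor : ¬ IsTorsionOver v δ) :
    ringVE V s = (addValuationRing w).toSubring := by
  refine le_antisymm (hw.ringVE_le hs hv) fun φ hφ => ?_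
  by_cases h0 : φ = 0
  · exact h0 ▸ (ringVE V s).zero_mem
  obtain ⟨c, k, hc, h⟩ := hs.exists_eventually_map_ratEval h0
  have hwφ := hw.map_eq_of_eventually_affine hδ hs h
  have h0w : 0 ≤ w φ := hφ
  rw [hwφ, ← WithTop.coe_zero, WithTop.coe_le_coe] at h0w
  rw [hs.mem_ringVE_iff hv]
  rcases h0w.eq_or_lt with h1 | h1
  · have hk := eq_zero_of_not_isTorsionOver htor hc h1.symm
    filter_upwards [h] with n hn
    rw [hn, ← WithTop.coe_zero, WithTop.coe_le_coe, h1, hk]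
    simp
  · filter_upwards [h, (hδ.tendsto_affine hs c k).eventually (lt_mem_nhds h1)] with n hn hn'
    rw [hn, ← WithTop.coe_zero, WithTop.coe_le_coe]
    exact hn'.le

/-- For torsion breadth, a suitable multiple of a power of a polynomial with increasing values has
values increasing to `0`. -/
theorem exists_polynomial_map_neg (hw : IsOstrowskiValuation v s w)
    (hδ : HasBreadth v s (δ : WithTop ℝ)) (hs : IsPseudoConvergent v s)
    (halg : IsAlgebraicType v s) (htor : IsTorsionOver v δ) :
    ∃ g : K[X], w (algebraMap K[X] (RatFunc K) g) = 0 ∧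
      ∀ᶠ n in atTop, v (g.eval (s n)) < 0 := by
  obtain ⟨f, hf⟩ := halg
  have hf0 : f ≠ 0 := by
    rintro rfl
    obtain ⟨n, hn⟩ := hf.exists
    simp at hn
  obtain ⟨c, k, ⟨N, hN, a, ha, hNa⟩, h⟩ := hs.exists_eventually_map_ratEval
    (RatFunc.algebraMap_ne_zero hf0)
  simp only [ratEval_algebraMap] at h
  have hk : 0 < k := by
    obtain ⟨n, h1, h2, h3⟩ := (hf.and (h.and ((tendsto_add_atTop_nat 1).eventually h))).exists
    rw [h2, h3, WithTop.coe_lt_coe] at h1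
    have hlt := hs.strictMono_seqGauge (Nat.lt_succ_self n)
    by_contra! hk
    have := mul_le_mul_of_nonpos_left hlt.le (by exact_mod_cast hk : (k : ℝ) ≤ 0)
    simp only [Nat.succ_eq_add_one] at this
    linarith
  lift k to ℕ using hk.le
  obtain ⟨m, hm, d, hd⟩ := htor
  have hd0 := ne_zero_of_map_eq_coe v hd
  have hd' := realVal_eq v hd
  -- With `N c = v a` and `m δ = v d`, the limit value `N m (c + k δ)` of `f ^ (N m)` is the value
  -- of `a ^ m * d ^ (N k)`.
  have hb0 : a ^ m * d ^ (N * k) ≠ 0 := mul_ne_zero (pow_ne_zero _ ha) (pow_ne_zero _ hd0)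
  have hb : realVal v (a ^ m * d ^ (N * k)) = N * m * (c + k * δ) := by
    rw [realVal_mul v (pow_ne_zero _ ha) (pow_ne_zero _ hd0), realVal_pow v ha, realVal_pow v hd0,
      ← hNa, hd']
    push_cast; ring
  have hg : ∀ᶠ n in atTop,
      v ((C (a ^ m * d ^ (N * k))⁻¹ * f ^ (N * m)).eval (s n)) =
        ((-(N * m * k * δ) + N * m * k * seqGauge v s n : ℝ) : WithTop ℝ) := by
    filter_upwards [h] with n hn
    have hne := ne_zero_of_map_eq_coe v hn
    rw [eval_mul, eval_C, eval_pow, ← coe_realVal v (mul_ne_zero (inv_ne_zero hb0)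
      (pow_ne_zero _ hne)), realVal_mul v (inv_ne_zero hb0) (pow_ne_zero _ hne), realVal_inv v hb0,
      hb, realVal_pow v hne, realVal_eq v hn]
    refine congrArg _ ?_
    push_cast; ring
  refine ⟨C (a ^ m * d ^ (N * k))⁻¹ * f ^ (N * m), ?_, ?_⟩
  · rw [hw.map_eq_of_eventually_affine hδ hs (c := -(N * m * k * δ)) (k := N * m * k)
      (by simpa only [ratEval_algebraMap] using hg)]
    simp
  · filter_upwards [hg] with n hn
    rw [hn, ← WithTop.coe_zero, WithTop.coe_lt_coe]
    have hpos : (0 : ℝ) < N * m * k := by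
      have : 0 < k := by exact_mod_cast hk
      positivity
    have := mul_lt_mul_of_pos_left (hδ.seqGauge_lt hs n) hpos
    linarith

end FiniteBreadth

/-! ### The residue field for non-torsion breadth -/

/-- A sequence `x` is asymptotically a principal unit if `x n - 1` eventually has value bounded
below by a positive constant. -/
def IsAsympPrincipalUnit {L : Type*} [Field L] (u : AddValuation L (WithTop ℝ)) (x : ℕ → L) :
    Prop :=
  ∃ ε : ℝ, 0 < ε ∧ ∀ᶠ n in atTop, (ε : WithTop ℝ) ≤ u (x n - 1)

namespace IsAsympPrincipalUnit

variable {L : Type*} [Field L] {u : AddValuation L (WithTop ℝ)} {x y : ℕ → L}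

theorem map_eq_zero {u : AddValuation L (WithTop ℝ)} {ε : ℝ} (hε : 0 < ε) {z : L}
    (h : (ε : WithTop ℝ) ≤ u (z - 1)) : u z = 0 := by
  have h1 : u 1 < u (z - 1) := by
    rw [u.map_one]
    exact lt_of_lt_of_le (by exact_mod_cast hε) h
  rw [u.map_eq_of_lt_sub h1, u.map_one]

theorem mul (hx : IsAsympPrincipalUnit u x) (hy : IsAsympPrincipalUnit u y) :
    IsAsympPrincipalUnit u (fun n => x n * y n) := by
  obtain ⟨ε, hε, hx⟩ := hx
  obtain ⟨ε', hε', hy⟩ := hy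
  refine ⟨min ε ε', lt_min hε hε', ?_⟩
  filter_upwards [hx, hy] with n hx hy
  have : x n * y n - 1 = x n * (y n - 1) + (x n - 1) := by ring
  rw [this]
  refine u.map_le_add ?_ ((WithTop.coe_le_coe.2 (min_le_left _ _)).trans hx)
  rw [u.map_mul, map_eq_zero hε hx, zero_add]
  exact (WithTop.coe_le_coe.2 (min_le_right _ _)).trans hy

theorem inv (hx : IsAsympPrincipalUnit u x) : IsAsympPrincipalUnit u (fun n => (x n)⁻¹) := by
  obtain ⟨ε, hε, hx⟩ := hx
  refine ⟨ε, hε, ?_⟩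
  filter_upwards [hx] with n hx
  have h0 := map_eq_zero hε hx
  have hne : x n ≠ 0 := by
    rw [← u.ne_top_iff, h0]; exact WithTop.zero_ne_top
  have h1 : (x n)⁻¹ - 1 = -((x n - 1) * (x n)⁻¹) := by field_simp; ring
  rw [h1, u.map_neg, u.map_mul, u.map_inv, h0, neg_zero, add_zero]
  exact hx

end IsAsympPrincipalUnit

section Residue

variable {K L : Type*} [Field K] [Field L] [Algebra K L] {v : AddValuation K (WithTop ℝ)}
  {s : ℕ → K} {δ : ℝ} {u : AddValuation L (WithTop ℝ)}

/-- A sequence of algebraic type has a pseudo-limit in every algebraically closed extension. -/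
theorem IsAlgebraicType.exists_pseudoLimit [IsAlgClosed L] (halg : IsAlgebraicType v s)
    (hs : IsPseudoConvergent v s) (hu : ∀ x, u (algebraMap K L x) = v x) :
    ∃ α : L, ∀ n, u (algebraMap K L (s n) - α) = ((seqGauge v s n : ℝ) : WithTop ℝ) := by
  by_contra! hno
  obtain ⟨f, hf⟩ := halg
  have hf0 : f ≠ 0 := by
    rintro rfl
    obtain ⟨n, hn⟩ := hf.exists
    simp at hn
  obtain ⟨c, hc⟩ := ratEval_induction (L := L) (s := s)
    (P := fun t => ∃ c : WithTop ℝ, ∀ᶠ n in atTop, u (t n) = c)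
    (fun b _ => ⟨u b, by simp⟩)
    (fun β => by
      rcases hs.map_sub_or hu β with h | ⟨m, -, h⟩
      · obtain ⟨n, hn⟩ := hno β
        exact absurd (h n) hn
      · exact ⟨_, (eventually_ge_atTop m).mono h⟩)
    (fun t t' ⟨c, h⟩ ⟨c', h'⟩ => ⟨c + c', by
      filter_upwards [h, h'] with n h h'
      rw [u.map_mul, h, h']⟩)
    (fun t ⟨c, h⟩ => ⟨-c, by
      filter_upwards [h] with n h
      rw [u.map_inv, h]⟩) (RatFunc.algebraMap_ne_zero hf0)
  simp only [ratEval_algebraMap, hu] at hc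
  obtain ⟨n, h1, h2, h3⟩ := (hf.and (hc.and ((tendsto_add_atTop_nat 1).eventually hc))).exists
  rw [h2, h3] at h1
  exact lt_irrefl _ h1

/-- If `α` is a pseudo-limit and the breadth is not torsion, every nonzero rational function is
along `s` asymptotic to a monomial `b (X - α) ^ k`. -/
theorem exists_isAsympPrincipalUnit [IsAlgClosed L] (hs : IsPseudoConvergent v s)
    (hδ : HasBreadth v s (δ : WithTop ℝ)) (hu : ∀ x, u (algebraMap K L x) = v x)
    (htors : ∀ y : L, y ≠ 0 → ∃ n : ℕ, 0 < n ∧ ∃ a : K, a ≠ 0 ∧ n * realVal u y = realVal v a)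
    (htor : ¬ IsTorsionOver v δ) {α : L}
    (hα : ∀ n, u (algebraMap K L (s n) - α) = ((seqGauge v s n : ℝ) : WithTop ℝ))
    {φ : RatFunc K} (hφ : φ ≠ 0) :
    ∃ b : L, b ≠ 0 ∧ ∃ k : ℤ, IsAsympPrincipalUnit u (fun n =>
      algebraMap K L (ratEval φ (s n)) / (b * (algebraMap K L (s n) - α) ^ k)) := by
  have hne : ∀ n, algebraMap K L (s n) - α ≠ 0 := fun n => ne_zero_of_map_eq_coe u (hα n)
  refine ratEval_induction (L := L) (s := s)
    (P := fun t => ∃ b : L, b ≠ 0 ∧ ∃ k : ℤ, IsAsympPrincipalUnit u (fun n =>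
      t n / (b * (algebraMap K L (s n) - α) ^ k))) ?_ ?_ ?_ ?_ hφ
  · intro b hb
    exact ⟨b, hb, 0, 1, one_pos, by simp [hb]⟩
  · intro β
    -- A pseudo-limit `β` gives `X - β ~ X - α`, because `u (α - β)` is torsion, hence exceeds `δ`
    -- strictly; any other `β` gives `X - β ~ α - β`.
    rcases hs.map_sub_or hu β with h | ⟨m, hm, -⟩
    · refine ⟨1, one_ne_zero, 1, ?_⟩
      have hquot : ∀ n, (algebraMap K L (s n) - β) / (1 * (algebraMap K L (s n) - α) ^ (1 : ℤ)) - 1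
          = (α - β) / (algebraMap K L (s n) - α) := by
        intro n
        have := hne n
        rw [one_mul, zpow_one, div_sub_one this]
        congr 1
        ring
      by_cases hαβ : α - β = 0
      · refine ⟨1, one_pos, Eventually.of_forall fun n => ?_⟩
        rw [hquot, hαβ, zero_div, u.map_zero]
        exact le_top
      have hge : δ ≤ realVal u (α - β) := by
        refine le_of_tendsto' (hδ.tendsto_seqGauge hs) fun n => ?_
        rw [← WithTop.coe_le_coe, coe_realVal u hαβ,
          ← sub_sub_sub_cancel_left β α (algebraMap K L (s n))]
        exact u.map_le_sub (h n).ge (hα n).ge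
      have hgt : δ < realVal u (α - β) := by
        refine lt_of_le_of_ne hge fun heq => htor ?_
        obtain ⟨N, hN, a, ha, hNa⟩ := htors _ hαβ
        exact ⟨N, hN, a, by rw [heq, hNa, coe_realVal v ha]⟩
      refine ⟨realVal u (α - β) - δ, sub_pos.2 hgt, Eventually.of_forall fun n => ?_⟩
      rw [hquot, ← coe_realVal u (div_ne_zero hαβ (hne n)), realVal_div u hαβ (hne n),
        realVal_eq u (hα n), WithTop.coe_le_coe]
      have := hδ.seqGauge_lt hs n
      linarith
    · have hβ0 : algebraMap K L (s m) - β ≠ 0 := (u.ne_top_iff).1 (ne_top_of_lt hm)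
      have hval : u (α - β) = u (algebraMap K L (s m) - β) := by
        rw [← sub_sub_sub_cancel_left β α (algebraMap K L (s m)), u.map_sub_eq_of_lt_left]
        rwa [hα]
      have hαβ : α - β ≠ 0 := by rwa [← u.ne_top_iff, hval, u.ne_top_iff]
      have hlt : realVal u (α - β) < seqGauge v s m := by
        rwa [← WithTop.coe_lt_coe, coe_realVal u hαβ, hval]
      refine ⟨α - β, hαβ, 0, seqGauge v s m - realVal u (α - β), sub_pos.2 hlt, ?_⟩
      filter_upwards [eventually_ge_atTop m] with n hn
      have hquot : (algebraMap K L (s n) - β) / ((α - β) * (algebraMap K L (s n) - α) ^ (0 : ℤ)) - 1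
          = (algebraMap K L (s n) - α) / (α - β) := by
        rw [zpow_zero, mul_one, div_sub_one hαβ]
        congr 1
        ring
      rw [hquot, ← coe_realVal u (div_ne_zero (hne n) hαβ), realVal_div u (hne n) hαβ,
        realVal_eq u (hα n), WithTop.coe_le_coe]
      have := hs.strictMono_seqGauge.monotone hn
      linarith
  · rintro t t' ⟨b, hb, k, h⟩ ⟨b', hb', k', h'⟩
    refine ⟨b * b', mul_ne_zero hb hb', k + k', ?_⟩
    convert h.mul h' using 2 with n
    rw [zpow_add₀ (hne n), div_mul_div_comm]
    congr 1
    ring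
  · rintro t ⟨b, hb, k, h⟩
    refine ⟨b⁻¹, inv_ne_zero hb, -k, ?_⟩
    convert h.inv using 2 with n
    rw [zpow_neg, ← mul_inv, inv_div, div_inv_eq_mul, inv_mul_eq_div]

/-- For non-torsion breadth, every element of value `0` has the residue of a constant. -/
theorem exists_map_sub_C_pos {w : AddValuation (RatFunc K) (WithTop ℝ)}
    (hw : IsOstrowskiValuation v s w) (hδ : HasBreadth v s (δ : WithTop ℝ))
    (hs : IsPseudoConvergent v s) (halg : IsAlgebraicType v s) (htor : ¬ IsTorsionOver v δ)
    {φ : RatFunc K} (hφ : w φ = 0) : ∃ a : K, 0 < w (φ - RatFunc.C a) := by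
  obtain ⟨u, hu, htors⟩ := exists_addValuation_extension (L := AlgebraicClosure K) v
  obtain ⟨α, hα⟩ := halg.exists_pseudoLimit hs hu
  have hφ0 : φ ≠ 0 := by
    rw [← w.ne_top_iff, hφ]; exact WithTop.zero_ne_top
  obtain ⟨b, hb, k, ε, hε, h⟩ := exists_isAsympPrincipalUnit hs hδ hu htors htor hα hφ0
  have hne : ∀ n, algebraMap K (AlgebraicClosure K) (s n) - α ≠ 0 :=
    fun n => ne_zero_of_map_eq_coe u (hα n)
  have hval : ∀ᶠ n in atTop,
      v (ratEval φ (s n)) = ((realVal u b + k * seqGauge v s n : ℝ) : WithTop ℝ) := by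
    filter_upwards [h, eventually_ratEval_ne_zero hs.injective hφ0] with n hn hn0
    have ht : algebraMap K (AlgebraicClosure K) (ratEval φ (s n)) ≠ 0 := by simpa using hn0
    have hy := zpow_ne_zero k (hne n)
    have hq := realVal_eq u (r := 0) (IsAsympPrincipalUnit.map_eq_zero hε hn)
    rw [realVal_div u ht (mul_ne_zero hb hy), realVal_mul u hb hy, realVal_zpow u (hne n),
      realVal_eq u (hα n)] at hq
    rw [← hu, ← coe_realVal u ht]
    exact congrArg _ (by linarith)
  have hw0 := hw.map_eq_of_eventually_affine hδ hs hval
  rw [hφ, ← WithTop.coe_zero, WithTop.coe_inj] at hw0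
  obtain rfl := eq_zero_of_not_isTorsionOver htor (htors b hb) hw0.symm
  have hb0 : u b = 0 := by
    rw [← coe_realVal u hb, ← WithTop.coe_zero, hw0]; simp
  have hclose : ∀ᶠ n in atTop, (ε : WithTop ℝ) ≤ u (algebraMap K _ (ratEval φ (s n)) - b) := by
    filter_upwards [h] with n hn
    rwa [zpow_zero, mul_one, div_sub_one hb, u.map_div, hb0, sub_zero] at hn
  -- The constant `b` lies in the algebraic closure, but a late value of `φ` along `s` is an element
  -- of `K` with the same residue.
  obtain ⟨m, hm⟩ := hclose.exists
  refine ⟨ratEval φ (s m), lt_of_lt_of_le (b := (ε : WithTop ℝ)) (by exact_mod_cast hε)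
    (ge_of_tendsto (hw _) ?_)⟩
  filter_upwards [hclose, eventually_ratEval_add hs.injective φ (RatFunc.C (-ratEval φ (s m)))]
    with n hn hadd
  rw [map_neg, ← sub_eq_add_neg] at hadd
  rw [hadd, ← map_neg, ratEval_C, ← sub_eq_add_neg, ← hu, _root_.map_sub,
    ← sub_sub_sub_cancel_right _ _ b]
  exact u.map_le_sub hn hm

end Residue

/-! ### Algebraic type with finite breadth: the equivalent conditions -/

section AddValuationRing

variable {F : Type*} [Field F] (w : AddValuation F (WithTop ℝ))

theorem mem_addValuationRing {x : F} : x ∈ addValuationRing w ↔ 0 ≤ w x := Iff.rfl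

theorem residue_addValuationRing_eq_zero_iff (x : addValuationRing w) :
    IsLocalRing.residue (addValuationRing w) x = 0 ↔ 0 < w x := by
  rw [IsLocalRing.residue_eq_zero_iff, ← ValuationSubring.coe_mem_nonunits_iff,
    ValuationSubring.mem_nonunits_iff_or]
  by_cases hx : (x : F) = 0
  · simp [hx]
  · rw [mem_addValuationRing, zero_le_map_iff w (inv_ne_zero hx), realVal_inv w hx,
      ← coe_realVal w hx, ← WithTop.coe_zero, WithTop.coe_lt_coe]
    simp [hx]

/-- The values of a monic integral polynomial at a point of negative value are not positive, since
a valuation ring is integrally closed. -/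
theorem map_eval_monic_nonpos {V : ValuationSubring F} (hv : ∀ x : F, x ∈ V ↔ 0 ≤ w x)
    {P : V[X]} (hP : P.Monic) {x : F} (hx : w x < 0) : w ((P.map V.subtype).eval x) ≤ 0 := by
  by_contra! hpos
  have hdeg : 0 < P.natDegree := by
    by_contra! h0
    rw [hP.natDegree_eq_zero.1 (Nat.le_zero.1 h0)] at hpos
    simp at hpos
  have hint : IsIntegral V x := by
    refine ⟨P - C ⟨_, (hv _).2 hpos.le⟩, hP.sub_of_left ?_, ?_⟩
    · exact degree_C_le.trans_lt (natDegree_pos_iff_degree_pos.1 hdeg)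
    · rw [eval₂_sub, eval₂_C, sub_eq_zero]
      exact (eval_map _ _).symm
  obtain ⟨y, rfl⟩ := IsIntegrallyClosed.isIntegral_iff.1 hint
  exact hx.not_ge ((hv _).1 y.2)

end AddValuationRing

section Equivalences

variable {K : Type*} [Field K] {V : ValuationSubring K} {v : AddValuation K (WithTop ℝ)}
  {s : ℕ → K} {δ : ℝ} {w : AddValuation (RatFunc K) (WithTop ℝ)}

/-- For torsion breadth, the residue of a polynomial with values increasing to `0` is
transcendental: a monic equation for it would have positive value for the limit valuation, but has
negative values along the sequence. -/
theorem isResiduallyTranscendental_of_isTorsionOver (hv : ∀ x : K, x ∈ V ↔ 0 ≤ v x)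
    (hw : IsOstrowskiValuation v s w) (hlies : LiesOverValuationRing V (addValuationRing w))
    {g : K[X]} (hg : w (algebraMap K[X] (RatFunc K) g) = 0)
    (hneg : ∀ᶠ n in atTop, v (g.eval (s n)) < 0) :
    IsResiduallyTranscendental hlies := by
  let _ := isLocalHom_inclusionOfLiesOver hlies
  let _ := (IsLocalRing.ResidueField.map (inclusionOfLiesOver hlies)).toAlgebra
  let z : addValuationRing w := ⟨algebraMap K[X] (RatFunc K) g, hg.ge⟩
  refine ⟨IsLocalRing.residue _ z, fun halg => ?_⟩
  obtain ⟨p, hp, hpz⟩ := isAlgebraic_iff_isIntegral.1 halg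
  obtain ⟨P, hPp, -, hP⟩ := lifts_and_natDegree_eq_and_monic
    (map_surjective (IsLocalRing.residue V) IsLocalRing.residue_surjective p) hp
  rw [← hPp, eval₂_map] at hpz
  have hcomp : (algebraMap (IsLocalRing.ResidueField V)
      (IsLocalRing.ResidueField (addValuationRing w))).comp (IsLocalRing.residue V) =
      (IsLocalRing.residue (addValuationRing w)).comp (inclusionOfLiesOver hlies) :=
    IsLocalRing.ResidueField.map_comp_residue _
  rw [hcomp, ← hom_eval₂, residue_addValuationRing_eq_zero_iff] at hpz
  have heval : ((P.eval₂ (inclusionOfLiesOver hlies) z : addValuationRing w) : RatFunc K) =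
      algebraMap K[X] (RatFunc K) ((P.map V.subtype).comp g) := by
    have h1 := hom_eval₂ P (inclusionOfLiesOver hlies) (addValuationRing w).subtype z
    rw [comp, eval₂_map, hom_eval₂]
    refine h1.trans (congrArg (fun f => eval₂ f _ P) (RingHom.ext fun c => ?_))
    exact (RatFunc.algebraMap_C (c : K)).symm
  rw [heval] at hpz
  have hlim := hw (algebraMap K[X] (RatFunc K) ((P.map V.subtype).comp g))
  obtain ⟨n, h1, h2⟩ := (hneg.and (hlim.eventually (lt_mem_nhds hpz))).exists
  rw [ratEval_algebraMap, eval_comp] at h2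
  exact (map_eval_monic_nonpos v hv hP h1).not_gt h2

/-- For non-torsion breadth, every residue of the limit valuation is the residue of an element of
`V`. -/
theorem not_isResiduallyTranscendental (hv : ∀ x : K, x ∈ V ↔ 0 ≤ v x)
    (hs : IsPseudoConvergent v s) (hw : IsOstrowskiValuation v s w)
    (hδ : HasBreadth v s (δ : WithTop ℝ)) (halg : IsAlgebraicType v s)
    (htor : ¬ IsTorsionOver v δ) (hlies : LiesOverValuationRing V (addValuationRing w)) :
    ¬ IsResiduallyTranscendental hlies := by
  let _ := isLocalHom_inclusionOfLiesOver hlies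
  let _ := (IsLocalRing.ResidueField.map (inclusionOfLiesOver hlies)).toAlgebra
  rintro ⟨z, hz⟩
  refine hz ?_
  obtain ⟨⟨φ, hφ⟩, rfl⟩ := IsLocalRing.residue_surjective z
  rcases (show 0 ≤ w φ from hφ).eq_or_lt with h0 | hpos
  · obtain ⟨a, ha⟩ := exists_map_sub_C_pos hw hδ hs halg htor h0.symm
    have hva : 0 ≤ v a := by
      rw [← hw.map_C, ← sub_sub_cancel φ (RatFunc.C a)]
      exact w.map_le_sub hφ ha.le
    have : IsLocalRing.residue (addValuationRing w) ⟨φ, hφ⟩ =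
        algebraMap (IsLocalRing.ResidueField V) (IsLocalRing.ResidueField (addValuationRing w))
          (IsLocalRing.residue V ⟨a, (hv a).2 hva⟩) := by
      change _ = IsLocalRing.residue (addValuationRing w)
        (inclusionOfLiesOver hlies ⟨a, (hv a).2 hva⟩)
      rw [← sub_eq_zero, ← _root_.map_sub, residue_addValuationRing_eq_zero_iff]
      exact ha
    rw [this]
    exact isAlgebraic_algebraMap _
  · rw [(residue_addValuationRing_eq_zero_iff w ⟨φ, hφ⟩).2 hpos]
    exact isAlgebraic_zero

theorem finiteBreadth_tfae (hV : ringKrullDim V = 1) (hv : ∀ x : K, x ∈ V ↔ 0 ≤ v x)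
    (hs : IsPseudoConvergent v s) (halg : IsAlgebraicType v s)
    (hδ : HasBreadth v s (δ : WithTop ℝ)) (hw : IsOstrowskiValuation v s w)
    (hlies : LiesOverValuationRing V (addValuationRing w)) :
    List.TFAE [
      ¬ IsTorsionOver v δ,
      ¬ IsResiduallyTranscendental hlies,
      ringKrullDim (ringVE V s) = 1,
      ringVE V s = (addValuationRing w).toSubring,
      ringVE V s ⊓ polynomialSubring K =
        (addValuationRing w).toSubring ⊓ polynomialSubring K] := by
  obtain ⟨x, -, hx⟩ := exists_map_neg_of_ringKrullDim hV hv
  have hx' : w (RatFunc.C x) < 0 := by rwa [hw.map_C]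
  tfae_have 1 → 2 := fun h => not_isResiduallyTranscendental hv hs hw hδ halg h hlies
  tfae_have 2 → 1 := fun h htor => by
    obtain ⟨g, hg, hneg⟩ := exists_polynomial_map_neg hw hδ hs halg htor
    exact h (isResiduallyTranscendental_of_isTorsionOver hv hw hlies hg hneg)
  tfae_have 1 → 4 := ringVE_eq_of_not_isTorsionOver hv hw hδ hs
  tfae_have 4 → 3 := fun h =>
    (ringKrullDim_subring_eq h).trans (ringKrullDim_addValuationRing w hx')
  tfae_have 3 → 4 := fun h => by
    let A := ValuationSubring.ofSubring (ringVE V s) (hs.mem_or_inv_mem_ringVE hv)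
    have hA : ringKrullDim A = 1 := h
    rcases A.eq_or_eq_top_of_ringKrullDim_eq_one hA (B := addValuationRing w)
      (hw.ringVE_le hs hv) with h | h
    · rw [h]; rfl
    · have : RatFunc.C x ∈ addValuationRing w := h ▸ ValuationSubring.mem_top _
      exact absurd this hx'.not_ge
  tfae_have 4 → 5 := fun h => by rw [h]
  tfae_have 5 → 1 := fun h htor => by
    obtain ⟨g, hg, hneg⟩ := exists_polynomial_map_neg hw hδ hs halg htor
    have hmem : algebraMap K[X] (RatFunc K) g ∈
        (addValuationRing w).toSubring ⊓ polynomialSubring K := ⟨hg.ge, ⟨g, rfl⟩⟩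
    rw [← h] at hmem
    refine (hs.notMem_ringVE_iff hv).2 ?_ hmem.1
    simpa only [ratEval_algebraMap] using hneg
  tfae_finish

end Equivalences

/-! ### Infinite breadth: the limit in the completion -/

section Completion

variable {K : Type*} [Field K] {V : ValuationSubring K} {v : AddValuation K (WithTop ℝ)}
  {s : ℕ → K}

theorem valuation_le_valuation_iff (hv : ∀ x : K, x ∈ V ↔ 0 ≤ v x) {x y : K} :
    V.valuation x ≤ V.valuation y ↔ v y ≤ v x := by
  by_cases hy : y = 0
  · subst hy
    rw [map_zero, v.map_zero, le_zero_iff, top_le_iff, v.top_iff, Valuation.zero_iff]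
  by_cases hx : x = 0
  · simp [hx]
  have h1 : V.valuation x ≤ V.valuation y ↔ x / y ∈ V := by
    rw [← V.valuation_le_one_iff, map_div₀,
      div_le_one₀ (zero_lt_iff.2 ((Valuation.ne_zero_iff _).2 hy))]
  rw [h1, hv, zero_le_map_iff v (div_ne_zero hx hy), realVal_div v hx hy, sub_nonneg,
    ← WithTop.coe_le_coe, coe_realVal v hx, coe_realVal v hy]

theorem valuation_lt_valuation_iff (hv : ∀ x : K, x ∈ V ↔ 0 ≤ v x) {x y : K} :
    V.valuation x < V.valuation y ↔ v y < v x := by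
  rw [← not_le, valuation_le_valuation_iff hv, not_le]

theorem valued_algebraMap (x : K) :
    (Valued.v (algebraMap K V.valuation.Completion x) : V.ValueGroup) = V.valuation x :=
  Valued.valuedCompletion_apply (WithVal.toVal V.valuation x)

/-- The completion has the same values as the field. -/
theorem exists_valued_eq (z : V.valuation.Completion) :
    ∃ r : K, (Valued.v z : V.ValueGroup) = V.valuation r := by
  obtain ⟨r, hr⟩ := Valued.exists_coe_eq_v z
  exact ⟨r.ofVal, hr⟩

theorem isOpen_valued_lt {R Γ : Type*} [Ring R] [LinearOrderedCommGroupWithZero Γ] [Valued R Γ]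
    (a : R) : IsOpen {x : R | Valued.v x < Valued.v a} := by
  simpa only [Valuation.restrict_lt_iff] using Valued.isOpen_ball R (Valued.v.restrict a)

theorem eventually_valued_sub_lt {t : ℕ → V.valuation.Completion} {z : V.valuation.Completion}
    (ht : Tendsto t atTop (𝓝 z)) {a : K} (ha : a ≠ 0) :
    ∀ᶠ n in atTop, Valued.v (z - t n) < V.valuation a := by
  have h0 : Tendsto (fun n => z - t n) atTop (𝓝 0) := by
    simpa using ht.const_sub z
  rw [← valued_algebraMap]
  refine h0.eventually ((isOpen_valued_lt _).mem_nhds ?_)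
  change Valued.v (0 : V.valuation.Completion) < _
  rw [map_zero, valued_algebraMap, zero_lt_iff]
  exact (Valuation.ne_zero_iff _).2 ha

theorem HasBreadth.eventually_gt (hb : HasBreadth v s ⊤) (R : WithTop ℝ) (hR : R ≠ ⊤) :
    ∀ᶠ n in atTop, R < v (s (n + 1) - s n) :=
  hb.eventually (lt_mem_nhds (lt_top_iff_ne_top.2 hR))

theorem exists_tendsto_completion (hv : ∀ x : K, x ∈ V ↔ 0 ≤ v x) (hs : IsPseudoConvergent v s)
    (hb : HasBreadth v s ⊤) :
    ∃ α : V.valuation.Completion,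
      Tendsto (fun n => algebraMap K V.valuation.Completion (s n)) atTop (𝓝 α) := by
  refine cauchySeq_tendsto_of_complete ?_
  rw [CauchySeq, Valued.cauchy_iff]
  refine ⟨inferInstance, fun γ => ?_⟩
  obtain ⟨z, hz⟩ := MonoidWithZeroHom.ValueGroup₀.restrict₀_surjective
    (.ofClass (Valued.v : Valuation V.valuation.Completion V.ValueGroup)) γ.1
  have hz0 : z ≠ 0 := by
    rintro rfl
    exact γ.ne_zero (by rw [← hz, map_zero])
  obtain ⟨r, hr⟩ := exists_valued_eq z
  have hr0 : r ≠ 0 := by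
    rw [← (V.valuation).ne_zero_iff, ← hr]
    exact (Valuation.ne_zero_iff _).2 hz0
  obtain ⟨N, hN⟩ := (hb.eventually_gt (v r) ((v.ne_top_iff).2 hr0)).exists_forall_of_atTop
  have key : ∀ m n, N ≤ m → m < n → V.valuation (s n - s m) < V.valuation r := by
    intro m n hm hmn
    rw [valuation_lt_valuation_iff hv, hs.map_sub hmn, ← hs.map_succ_sub]
    exact hN m hm
  -- Mathlib's uniformity is expressed by the valuation restricted to its own value group.
  have hball : ∀ x y : K, V.valuation (y - x) < V.valuation r →
      (Valued.v : Valuation V.valuation.Completion V.ValueGroup).restrict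
        (algebraMap K V.valuation.Completion y - algebraMap K V.valuation.Completion x) < γ.1 := by
    intro x y h
    rw [← hz, ← Valuation.restrict_def, Valuation.restrict_lt_iff, ← map_sub, valued_algebraMap, hr]
    exact h
  refine ⟨_, image_mem_map (Ici_mem_atTop N), ?_⟩
  rintro _ ⟨m, hm, rfl⟩ _ ⟨n, hn, rfl⟩
  refine hball _ _ ?_
  rcases lt_trichotomy m n with h | rfl | h
  · exact key m n hm h
  · rw [sub_self, map_zero, zero_lt_iff]
    exact (Valuation.ne_zero_iff _).2 hr0
  · rw [Valuation.map_sub_swap]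
    exact key n m hn h

variable {α : V.valuation.Completion}

theorem valued_limit_sub (hv : ∀ x : K, x ∈ V ↔ 0 ≤ v x) (hs : IsPseudoConvergent v s)
    (hα : Tendsto (fun n => algebraMap K V.valuation.Completion (s n)) atTop (𝓝 α)) (n : ℕ) :
    (Valued.v (α - algebraMap K V.valuation.Completion (s n)) : V.ValueGroup) =
      V.valuation (s (n + 1) - s n) := by
  have hne := ne_zero_of_map_eq_coe v (hs.map_succ_sub n)
  obtain ⟨m, hm, hnm⟩ := ((eventually_valued_sub_lt hα hne).and (eventually_gt_atTop n)).exists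
  have hval : (Valued.v (algebraMap K V.valuation.Completion (s m) -
      algebraMap K V.valuation.Completion (s n)) : V.ValueGroup) =
      V.valuation (s (n + 1) - s n) := by
    rw [← map_sub, valued_algebraMap]
    refine le_antisymm ?_ ?_ <;> rw [valuation_le_valuation_iff hv, hs.map_sub hnm, hs.map_succ_sub]
  rw [← sub_add_sub_cancel _ (algebraMap K V.valuation.Completion (s m)),
    Valuation.map_add_eq_of_lt_right, hval]
  rwa [hval]

/-- A pseudo-limit in the completion has distances to the `s n` with values tending to infinity, so
it is the topological limit. -/
theorem isPseudoLimit_iff_eq (hv : ∀ x : K, x ∈ V ↔ 0 ≤ v x) (hs : IsPseudoConvergent v s)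
    (hb : HasBreadth v s ⊤)
    (hα : Tendsto (fun n => algebraMap K V.valuation.Completion (s n)) atTop (𝓝 α))
    (β : V.valuation.Completion) :
    IsPseudoLimit Valued.v (fun n => algebraMap K V.valuation.Completion (s n)) β ↔ β = α := by
  constructor
  · intro hβ
    by_contra hne
    obtain ⟨r, hr⟩ := exists_valued_eq (β - α)
    have hr0 : r ≠ 0 := by
      rw [← (V.valuation).ne_zero_iff, ← hr]
      exact (Valuation.ne_zero_iff _).2 (sub_ne_zero.2 hne)
    obtain ⟨n, hn⟩ := (hb.eventually_gt (v r) ((v.ne_top_iff).2 hr0)).exists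
    rw [← valuation_lt_valuation_iff hv] at hn
    have h1 : (Valued.v (β - algebraMap K V.valuation.Completion (s n)) : V.ValueGroup) =
        V.valuation (s (n + 1) - s n) := by
      rw [← valued_algebraMap, map_sub (algebraMap K V.valuation.Completion),
        ← sub_sub_sub_cancel_left (algebraMap K V.valuation.Completion (s n))
          (algebraMap K V.valuation.Completion (s (n + 1))) β]
      exact (Valuation.map_sub_eq_of_lt_left _ (hβ n)).symm
    have h2 : (Valued.v (β - α) : V.ValueGroup) ≤ V.valuation (s (n + 1) - s n) := by
      rw [← sub_sub_sub_cancel_right β α (algebraMap K V.valuation.Completion (s n))]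
      exact Valuation.map_sub_le _ h1.le (valued_limit_sub hv hs hα n).le
    rw [hr] at h2
    exact hn.not_ge h2
  · rintro rfl n
    rw [valued_limit_sub hv hs hα, valued_limit_sub hv hs hα, valuation_lt_valuation_iff hv]
    exact hs n

theorem tendsto_aeval (hα : Tendsto (fun n => algebraMap K V.valuation.Completion (s n))
    atTop (𝓝 α)) (f : K[X]) :
    Tendsto (fun n => algebraMap K V.valuation.Completion (f.eval (s n))) atTop
      (𝓝 (aeval α f)) := by
  have h := ((f.continuous_aeval (A := V.valuation.Completion)).tendsto α).comp hα
  refine h.congr fun n => ?_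
  simp [aeval_algebraMap_apply]

theorem eventually_map_eval_eq (hv : ∀ x : K, x ∈ V ↔ 0 ≤ v x)
    (hα : Tendsto (fun n => algebraMap K V.valuation.Completion (s n)) atTop (𝓝 α)) {f : K[X]}
    (hf : aeval α f ≠ 0) :
    ∃ c : ℝ, ∀ᶠ n in atTop, v (f.eval (s n)) = (c : WithTop ℝ) := by
  have h := (tendsto_aeval hα f).eventually (Valued.locally_const ((Valuation.ne_zero_iff _).2 hf))
  simp only [valued_algebraMap] at h
  obtain ⟨m, hm⟩ := h.exists
  have hm0 : f.eval (s m) ≠ 0 := by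
    rw [← (V.valuation).ne_zero_iff, hm]
    exact (Valuation.ne_zero_iff _).2 hf
  refine ⟨realVal v (f.eval (s m)), ?_⟩
  filter_upwards [h] with n hn
  rw [coe_realVal v hm0]
  exact le_antisymm ((valuation_le_valuation_iff hv).1 (hm.trans hn.symm).le)
    ((valuation_le_valuation_iff hv).1 (hn.trans hm.symm).le)

theorem eventually_lt_map_eval (hv : ∀ x : K, x ∈ V ↔ 0 ≤ v x) (hs : IsPseudoConvergent v s)
    (hb : HasBreadth v s ⊤)
    (hα : Tendsto (fun n => algebraMap K V.valuation.Completion (s n)) atTop (𝓝 α)) {f : K[X]}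
    (hf : aeval α f = 0) (R : ℝ) :
    ∀ᶠ n in atTop, (R : WithTop ℝ) < v (f.eval (s n)) := by
  obtain ⟨m, hm⟩ := (hb.eventually_gt R WithTop.coe_ne_top).exists
  have hne := ne_zero_of_map_eq_coe v (hs.map_succ_sub m)
  filter_upwards [eventually_valued_sub_lt (tendsto_aeval hα f) hne] with n hn
  rw [hf, zero_sub, Valuation.map_neg, valued_algebraMap, valuation_lt_valuation_iff hv] at hn
  exact hm.trans hn

/-- The limit is a root of any polynomial with increasing values along `s`, since elsewhere the
valuation is locally constant. -/
theorem isIntegral_limit (hv : ∀ x : K, x ∈ V ↔ 0 ≤ v x)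
    (hα : Tendsto (fun n => algebraMap K V.valuation.Completion (s n)) atTop (𝓝 α))
    (halg : IsAlgebraicType v s) : IsIntegral K α := by
  obtain ⟨f, hf⟩ := halg
  rw [← isAlgebraic_iff_isIntegral]
  refine ⟨f, ?_, ?_⟩
  · rintro rfl
    obtain ⟨n, hn⟩ := hf.exists
    simp at hn
  · by_contra hne
    obtain ⟨c, hc⟩ := eventually_map_eval_eq hv hα hne
    obtain ⟨n, h1, h2, h3⟩ := (hf.and (hc.and ((tendsto_add_atTop_nat 1).eventually hc))).exists
    rw [h2, h3] at h1
    exact lt_irrefl _ h1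

end Completion

/-! ### Infinite breadth: the overrings of `V_E` -/

section InfiniteBreadth

variable {K : Type*} [Field K] {V : ValuationSubring K} {v : AddValuation K (WithTop ℝ)}
  {s : ℕ → K} {q : K[X]}

theorem eventually_ratEval_div (hs : IsPseudoConvergent v s) (f : K[X]) {g : K[X]} (hg : g ≠ 0) :
    ∀ᶠ n in atTop, ratEval (algebraMap K[X] (RatFunc K) f / algebraMap K[X] (RatFunc K) g) (s n) =
      f.eval (s n) / g.eval (s n) := by
  have hg' := RatFunc.algebraMap_ne_zero hg
  filter_upwards [eventually_ratEval_mul hs.injective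
    (algebraMap K[X] (RatFunc K) f / algebraMap K[X] (RatFunc K) g) (algebraMap K[X] (RatFunc K) g),
    eventually_eval_ne_zero hs.injective hg] with n h1 h2
  rw [div_mul_cancel₀ _ hg', ratEval_algebraMap, ratEval_algebraMap] at h1
  rw [h1, mul_div_cancel_right₀ _ h2]

/-- A prime polynomial `q` governs the values along `s` if polynomials prime to `q` eventually have
constant finite values, while the values of multiples of `q` tend to infinity. The minimal
polynomial of the limit of `s` has this property. -/
structure GovernsValues (v : AddValuation K (WithTop ℝ)) (s : ℕ → K) (q : K[X]) : Prop where
  eventually_eq : ∀ f : K[X], ¬ q ∣ f → ∃ c : ℝ, ∀ᶠ n in atTop, v (f.eval (s n)) = (c : WithTop ℝ)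
  eventually_gt : ∀ f : K[X], q ∣ f → ∀ R : ℝ, ∀ᶠ n in atTop, (R : WithTop ℝ) < v (f.eval (s n))

namespace GovernsValues

theorem div_mem_ringVE (h : GovernsValues v s q) (hs : IsPseudoConvergent v s)
    (hv : ∀ x : K, x ∈ V ↔ 0 ≤ v x) {f g : K[X]} (hf : q ∣ f) (hg : ¬ q ∣ g) :
    algebraMap K[X] (RatFunc K) f / algebraMap K[X] (RatFunc K) g ∈ ringVE V s := by
  have hg0 : g ≠ 0 := by rintro rfl; exact hg (dvd_zero q)
  obtain ⟨c, hc⟩ := h.eventually_eq g hg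
  rw [hs.mem_ringVE_iff hv]
  filter_upwards [eventually_ratEval_div hs f hg0, hc, h.eventually_gt f hf c] with n h1 h2 h3
  rw [h1]
  by_cases hf0 : f.eval (s n) = 0
  · simp [hf0]
  have hgn := ne_zero_of_map_eq_coe v h2
  rw [← coe_realVal v hf0, WithTop.coe_lt_coe] at h3
  rw [zero_le_map_iff v (div_ne_zero hf0 hgn), realVal_div v hf0 hgn, realVal_eq v h2]
  linarith

theorem ringVE_le (h : GovernsValues v s q) (hs : IsPseudoConvergent v s)
    (hv : ∀ x : K, x ∈ V ↔ 0 ≤ v x) (hq : Prime q) : ringVE V s ≤ localizationAt q hq := by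
  intro φ hφ
  by_contra hnot
  have hd : q ∣ φ.denom := by
    by_contra hd
    exact hnot ⟨φ.num, φ.denom, hd, (RatFunc.num_div_denom φ).symm⟩
  have hn : ¬ q ∣ φ.num := fun hn =>
    hq.not_isUnit ((RatFunc.isCoprime_num_denom φ).isUnit_of_dvd' hn hd)
  obtain ⟨c, hc⟩ := h.eventually_eq _ hn
  refine (hs.notMem_ringVE_iff hv).2 ?_ hφ
  have hdiv := eventually_ratEval_div hs φ.num φ.denom_ne_zero
  rw [RatFunc.num_div_denom] at hdiv
  filter_upwards [hdiv, hc, h.eventually_gt _ hd c,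
    eventually_denom_ne_zero hs.injective φ] with n h1 h2 h3 h4
  have hne := ne_zero_of_map_eq_coe v h2
  rw [← coe_realVal v h4, WithTop.coe_lt_coe] at h3
  rw [h1, ← not_le, zero_le_map_iff v (div_ne_zero hne h4), realVal_div v hne h4, realVal_eq v h2]
  linarith

/-- A ring containing `V_E` and an element with a pole along `q` is everything: the inverse of that
element is divisible by `q`, and its high powers clear the poles of any rational function. -/
theorem eq_top_of_not_le (h : GovernsValues v s q) (hs : IsPseudoConvergent v s)
    (hv : ∀ x : K, x ∈ V ↔ 0 ≤ v x) (hq : Prime q) {A : Subring (RatFunc K)} (hA : ringVE V s ≤ A)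
    (hnot : ¬ A ≤ localizationAt q hq) : A = ⊤ := by
  obtain ⟨φ, hφA, hφ⟩ := SetLike.not_le_iff_exists.1 hnot
  have hd : q ∣ φ.denom := by
    by_contra hd
    exact hφ ⟨φ.num, φ.denom, hd, (RatFunc.num_div_denom φ).symm⟩
  have hn : ¬ q ∣ φ.num := fun hn =>
    hq.not_isUnit ((RatFunc.isCoprime_num_denom φ).isUnit_of_dvd' hn hd)
  obtain ⟨e, he⟩ := hd
  have hn0 : φ.num ≠ 0 := by intro h0; exact hn (h0 ▸ dvd_zero q)
  have he0 : e ≠ 0 := by rintro rfl; exact φ.denom_ne_zero (by rw [he, mul_zero])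
  refine eq_top_iff.2 fun χ _ => ?_
  obtain ⟨g, hχ, hg⟩ := (FiniteMultiplicity.of_prime_left hq
    χ.denom_ne_zero).exists_eq_pow_mul_and_not_dvd
  generalize multiplicity q χ.denom = j at hχ
  have hmem := h.div_mem_ringVE hs hv (f := χ.num * q * e ^ (j + 1)) (g := g * φ.num ^ (j + 1))
    ⟨χ.num * e ^ (j + 1), by ring⟩
    (fun hdvd => (hq.dvd_or_dvd hdvd).elim hg fun h' => hn (hq.dvd_of_dvd_pow h'))
  have hg0 : g ≠ 0 := by rintro rfl; exact hg (dvd_zero q)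
  have hχ' : χ = algebraMap K[X] (RatFunc K) (χ.num * q * e ^ (j + 1)) /
      algebraMap K[X] (RatFunc K) (g * φ.num ^ (j + 1)) * φ ^ (j + 1) := by
    have h1 := RatFunc.algebraMap_ne_zero hn0
    have h2 := RatFunc.algebraMap_ne_zero he0
    have h3 := RatFunc.algebraMap_ne_zero hg0
    have h4 := RatFunc.algebraMap_ne_zero hq.ne_zero
    calc χ = algebraMap K[X] (RatFunc K) χ.num / algebraMap K[X] (RatFunc K) (q ^ j * g) := by
          rw [← hχ, RatFunc.num_div_denom]
      _ = algebraMap K[X] (RatFunc K) (χ.num * q * e ^ (j + 1)) /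
          algebraMap K[X] (RatFunc K) (g * φ.num ^ (j + 1)) *
          (algebraMap K[X] (RatFunc K) φ.num / algebraMap K[X] (RatFunc K) (q * e)) ^ (j + 1) := by
        simp only [map_mul, map_pow, div_pow, mul_pow]
        field_simp
        ring
      _ = _ := by rw [← he, RatFunc.num_div_denom]
  rw [hχ']
  exact A.mul_mem (hA hmem) (pow_mem hφA _)

/-- There is no ring strictly between `V_E` and the localization, because on quotients of
polynomials prime to `q` membership in `V_E` is decided by a real value. -/
theorem eq_or_eq_of_le (h : GovernsValues v s q) (hs : IsPseudoConvergent v s)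
    (hv : ∀ x : K, x ∈ V ↔ 0 ≤ v x) (hq : Prime q) {A : Subring (RatFunc K)} (hA : ringVE V s ≤ A)
    (hle : A ≤ localizationAt q hq) : A = ringVE V s ∨ A = localizationAt q hq := by
  refine or_iff_not_imp_left.2 fun hne => le_antisymm hle ?_
  obtain ⟨φ, hφA, hφ⟩ := SetLike.exists_of_lt (lt_of_le_of_ne hA (Ne.symm hne))
  obtain ⟨f, g, hg, rfl⟩ := hle hφA
  have hf : ¬ q ∣ f := fun hf => hφ (h.div_mem_ringVE hs hv hf hg)
  have hf0 : f ≠ 0 := by rintro rfl; exact hf (dvd_zero q)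
  have hg0 : g ≠ 0 := by rintro rfl; exact hg (dvd_zero q)
  obtain ⟨a, ha⟩ := h.eventually_eq f hf
  obtain ⟨b, hb⟩ := h.eventually_eq g hg
  have hab : a - b < 0 := by
    rw [hs.notMem_ringVE_iff hv] at hφ
    obtain ⟨n, h1, h2, h3, h4⟩ :=
      (hφ.and (ha.and (hb.and (eventually_ratEval_div hs f hg0)))).exists
    have hfn := ne_zero_of_map_eq_coe v h2
    have hgn := ne_zero_of_map_eq_coe v h3
    rwa [h4, ← not_le, zero_le_map_iff v (div_ne_zero hfn hgn), realVal_div v hfn hgn,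
      realVal_eq v h2, realVal_eq v h3, not_le] at h1
  rintro _ ⟨f', g', hg', rfl⟩
  by_cases hf' : q ∣ f'
  · exact hA (h.div_mem_ringVE hs hv hf' hg')
  have hg0' : g' ≠ 0 := by rintro rfl; exact hg' (dvd_zero q)
  obtain ⟨a', ha'⟩ := h.eventually_eq f' hf'
  obtain ⟨b', hb'⟩ := h.eventually_eq g' hg'
  obtain ⟨N, hN⟩ := Archimedean.arch (b' - a') (neg_pos.2 hab)
  rw [nsmul_eq_mul] at hN
  have hmem : algebraMap K[X] (RatFunc K) (f' * g ^ N) / algebraMap K[X] (RatFunc K) (g' * f ^ N) ∈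
      ringVE V s := by
    rw [hs.mem_ringVE_iff hv]
    filter_upwards [ha, hb, ha', hb', eventually_ratEval_div hs (f' * g ^ N)
      (mul_ne_zero hg0' (pow_ne_zero N hf0))] with n h1 h2 h3 h4 h5
    have k1 := ne_zero_of_map_eq_coe v h1
    have k2 := ne_zero_of_map_eq_coe v h2
    have k3 := ne_zero_of_map_eq_coe v h3
    have k4 := ne_zero_of_map_eq_coe v h4
    have k5 := mul_ne_zero k3 (pow_ne_zero N k2)
    have k6 := mul_ne_zero k4 (pow_ne_zero N k1)
    rw [h5, eval_mul, eval_mul, eval_pow, eval_pow, zero_le_map_iff v (div_ne_zero k5 k6),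
      realVal_div v k5 k6, realVal_mul v k3 (pow_ne_zero N k2), realVal_mul v k4 (pow_ne_zero N k1),
      realVal_pow v k2, realVal_pow v k1, realVal_eq v h1, realVal_eq v h2, realVal_eq v h3,
      realVal_eq v h4]
    linarith
  have hprod : algebraMap K[X] (RatFunc K) f' / algebraMap K[X] (RatFunc K) g' =
      algebraMap K[X] (RatFunc K) (f' * g ^ N) / algebraMap K[X] (RatFunc K) (g' * f ^ N) *
        (algebraMap K[X] (RatFunc K) f / algebraMap K[X] (RatFunc K) g) ^ N := by
    have h1 := RatFunc.algebraMap_ne_zero hf0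
    have h2 := RatFunc.algebraMap_ne_zero hg0
    have h3 := RatFunc.algebraMap_ne_zero hg0'
    simp only [map_mul, map_pow, div_pow]
    field_simp
  rw [hprod]
  exact A.mul_mem (hA hmem) (pow_mem hφA N)

theorem eq_or_eq_or_eq_top (h : GovernsValues v s q) (hs : IsPseudoConvergent v s)
    (hv : ∀ x : K, x ∈ V ↔ 0 ≤ v x) (hq : Prime q) {A : Subring (RatFunc K)}
    (hA : ringVE V s ≤ A) : A = ringVE V s ∨ A = localizationAt q hq ∨ A = ⊤ := by
  by_cases hle : A ≤ localizationAt q hq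
  · exact (h.eq_or_eq_of_le hs hv hq hA hle).imp_right Or.inl
  · exact Or.inr (Or.inr (h.eq_top_of_not_le hs hv hq hA hle))

theorem ringKrullDim_ringVE (h : GovernsValues v s q) (hV : ringKrullDim V = 1)
    (hs : IsPseudoConvergent v s) (hv : ∀ x : K, x ∈ V ↔ 0 ≤ v x) (hq : Prime q) :
    ringKrullDim (ringVE V s) = 2 ∧ ∀ A : Subring (RatFunc K), ringVE V s ≤ A →
      (ringKrullDim A = 1 ↔ A = localizationAt q hq) := by
  have hle := h.ringVE_le hs hv hq
  -- Both rings are valuation rings, so that their ranks can be read off from their overrings.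
  let VE := ValuationSubring.ofSubring (ringVE V s) (hs.mem_or_inv_mem_ringVE hv)
  let B := ValuationSubring.ofSubring (localizationAt q hq) fun φ =>
    (hs.mem_or_inv_mem_ringVE hv φ).imp (fun h => hle h) (fun h => hle h)
  have hcases : ∀ C : ValuationSubring (RatFunc K), VE ≤ C → C = VE ∨ C = B ∨ C = ⊤ := by
    intro C hC
    rcases h.eq_or_eq_or_eq_top hs hv hq (A := C.toSubring) hC with h | h | h
    · exact Or.inl (ValuationSubring.toSubring_injective h)
    · exact Or.inr (Or.inl (ValuationSubring.toSubring_injective h))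
    · exact Or.inr (Or.inr (ValuationSubring.toSubring_injective h))
  have hVEB : VE < B := by
    refine lt_of_le_of_ne hle fun heq => ?_
    obtain ⟨x, -, hx⟩ := exists_map_neg_of_ringKrullDim hV hv
    have hmem : RatFunc.C x ∈ B := ⟨C x, 1, fun hd => hq.not_isUnit (isUnit_of_dvd_one hd), by
      simp⟩
    rw [← heq] at hmem
    refine (hs.notMem_ringVE_iff hv).2 ?_ hmem
    simpa only [ratEval_C, eventually_const] using hx
  have hBtop : B < ⊤ := by
    refine lt_of_le_of_ne B.le_top fun heq => ?_
    have hmem : (algebraMap K[X] (RatFunc K) q)⁻¹ ∈ B := heq ▸ ValuationSubring.mem_top _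
    obtain ⟨f, g, hg, hfg⟩ := hmem
    have hg0 : g ≠ 0 := by rintro rfl; exact hg (dvd_zero q)
    have h1 := RatFunc.algebraMap_ne_zero hg0
    have h2 := RatFunc.algebraMap_ne_zero hq.ne_zero
    rw [inv_eq_one_div, div_eq_div_iff h2 h1, one_mul, ← map_mul] at hfg
    exact hg ⟨f, by rw [mul_comm, ← RatFunc.algebraMap_injective K hfg]⟩
  have hdim : ringKrullDim (ringVE V s) = 2 := VE.ringKrullDim_eq_two hVEB hBtop hcases
  refine ⟨hdim, fun A hA => ⟨fun hA1 => ?_, ?_⟩⟩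
  · rcases h.eq_or_eq_or_eq_top hs hv hq hA with rfl | rfl | rfl
    · rw [hdim] at hA1
      exact absurd hA1 (by decide)
    · rfl
    · have h0 : ringKrullDim (⊤ : Subring (RatFunc K)) = 0 :=
        ValuationSubring.ringKrullDim_top
      rw [h0] at hA1
      exact absurd hA1 zero_ne_one
  · rintro rfl
    refine B.ringKrullDim_eq_one hBtop.ne fun C hC => (hcases C (hVEB.le.trans hC)).resolve_left ?_
    rintro rfl
    exact hVEB.not_ge hC

end GovernsValues

/-- Everything about infinite breadth follows from the minimal polynomial of the limit governing
the values along the sequence. -/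
theorem infiniteBreadth (hV : ringKrullDim V = 1) (hs : IsPseudoConvergent v s)
    (hv : ∀ x : K, x ∈ V ↔ 0 ≤ v x) (halg : IsAlgebraicType v s) (hb : HasBreadth v s ⊤) :
    ringKrullDim (ringVE V s) = 2 ∧
      ∃ (α : V.valuation.Completion) (hα : IsIntegral K α),
        (∀ β : V.valuation.Completion,
          IsPseudoLimit Valued.v (fun n => algebraMap K V.valuation.Completion (s n)) β ↔ β = α) ∧
        ringVE V s ≤ localizationAt (minpoly K α) (minpoly.prime hα) ∧
        ∀ A : Subring (RatFunc K), ringVE V s ≤ A →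
          (ringKrullDim A = 1 ↔ A = localizationAt (minpoly K α) (minpoly.prime hα)) := by
  obtain ⟨α, hlim⟩ := exists_tendsto_completion hv hs hb
  have hα := isIntegral_limit hv hlim halg
  have h : GovernsValues v s (minpoly K α) :=
    { eventually_eq := fun f hf => eventually_map_eval_eq hv hlim fun h0 => hf (minpoly.dvd K α h0)
      eventually_gt := fun f hf => eventually_lt_map_eval hv hs hb hlim
        ((minpoly.dvd_iff).1 hf) }
  have hdim := h.ringKrullDim_ringVE hV hs hv (minpoly.prime hα)
  exact ⟨hdim.1, α, hα, isPseudoLimit_iff_eq hv hs hb hlim, h.ringVE_le hs hv _, hdim.2⟩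

end InfiniteBreadth

theorem theorem4p6 {K : Type*} [Field K] (V : ValuationSubring K) (hV : ringKrullDim V = 1)
    (v : AddValuation K (WithTop ℝ)) (hv : ∀ x : K, x ∈ V ↔ 0 ≤ v x)
    (s : ℕ → K) (hs : IsPseudoConvergent v s) :
    -- `V_E` is a valuation domain of `K(X)`
    (∀ φ : RatFunc K, φ ∈ ringVE V s ∨ φ⁻¹ ∈ ringVE V s) ∧
    -- transcendental type
    (IsTranscendentalType v s →
      ∃ w : AddValuation (RatFunc K) (WithTop ℝ), IsOstrowskiValuation v s w ∧
        ringVE V s = (addValuationRing w).toSubring ∧ ringKrullDim (ringVE V s) = 1) ∧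
    -- algebraic type, infinite breadth
    (IsAlgebraicType v s → HasBreadth v s ⊤ →
      ringKrullDim (ringVE V s) = 2 ∧
      ∃ (α : V.valuation.Completion) (hα : IsIntegral K α),
        (∀ β : V.valuation.Completion,
          IsPseudoLimit Valued.v (fun n => algebraMap K V.valuation.Completion (s n)) β ↔ β = α) ∧
        ringVE V s ≤ localizationAt (minpoly K α) (minpoly.prime hα) ∧
        ∀ A : Subring (RatFunc K), ringVE V s ≤ A →
          (ringKrullDim A = 1 ↔ A = localizationAt (minpoly K α) (minpoly.prime hα))) ∧
    -- algebraic type, finite breadth `δ`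
    (∀ δ : ℝ, IsAlgebraicType v s → HasBreadth v s (δ : WithTop ℝ) →
      ∃ w : AddValuation (RatFunc K) (WithTop ℝ), IsOstrowskiValuation v s w ∧
        ∃ hw : LiesOverValuationRing V (addValuationRing w),
          List.TFAE [
            ¬ IsTorsionOver v δ,
            ¬ IsResiduallyTranscendental hw,
            ringKrullDim (ringVE V s) = 1,
            ringVE V s = (addValuationRing w).toSubring,
            ringVE V s ⊓ polynomialSubring K =
              (addValuationRing w).toSubring ⊓ polynomialSubring K]) := by
  refine ⟨hs.mem_or_inv_mem_ringVE hv,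
    exists_isOstrowskiValuation_of_isTranscendentalType hV hv hs,
    infiniteBreadth hV hs hv, fun δ halg hδ => ?_⟩
  obtain ⟨w, hw⟩ := hδ.exists_isOstrowskiValuation hs
  have hlies : LiesOverValuationRing V (addValuationRing w) := fun x => by
    rw [hv, ← hw.map_C]
    rfl
  exact ⟨w, hw, hlies, finiteBreadth_tfae hV hv hs halg hδ hw hlies⟩
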